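/- **Setting.** Fix $d\ge 1$ and let $\mathcal S$ be the set of quantum channels (completely positive trace preserving linear maps) on the operators on $\mathbb C^d$. Represent $\mathcal S$ in $V=\mathbb R^D$ by an affine map that is injective on $\mathcal S$, and identify channels with their images. Let $\mathcal F\subseteq\mathcal S$ be a compact star domain, i.e. its kernel $\mathrm{Ker}(\mathcal F)=\{\mu_0\in\mathcal F:\lambda\mu_0+(1-\lambda)\mu\in\mathcal F\ \forall \mu\in\mathcal F,\lambda\in[0,1]\}$ is non-empty. Let $\mathfrak T$ be a fortress of $\mathcal F$: a collection of convex cones $\mathcal C\subseteq V$, each with an apex $v_0$, such that $\mathcal F$ and the cones cover $V$, $\mathcal F\cap \mathrm{Int}(\mathcal C)=\emptyset$ and $\mathrm{Ker}(\mathcal F)\subseteq\{2v_0-v: v\in\mathcal C\}$ for every cone, $\partial\mathcal F=\bigcup_{\mathcal C\in\mathfrak T}(\mathcal C\cap\mathcal F)$, and $\mathcal C\cap\mathcal F\ne\emptyset$ for every cone. Fix $\mathcal C\in\mathfrak T$. A convex component of $\mathcal F$ is an inclusion-maximal convex subset of $\mathcal F$. For every inclusion-maximal member $\mathcal J$ of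 $\{\mathcal A\cap\mathcal C:\mathcal A\text{ a convex component of }\mathcal F\}$, the intersection of all the convex components $\mathcal A$ with $\mathcal A\cap\mathcal C=\mathcal J$ is called a free section. Assume that there are finitely many free sections, listed without repetition as $\mathcal F_1,\dots,\mathcal F_M$, and let $\mathcal D=\mathcal C\cup\bigcup_j\mathcal F_j$ be the domain of $\mathcal C$. For a channel $\Theta$ and a set $\mathcal X$ of channels the generalised robustness is $$\mathcal R(\Theta\mid\mathcal X)=\min\Big\{r\ge0:\ \tfrac{\Theta+r\Lambda}{1+r}\in\mathcal X\text{ for some channel }\Lambda\Big\},$$ and it is finite if this set of numbers $r$ is non-empty. **Games.** A comb-discrimination game with $m\ge1$ slots consists of probabilities $p_1,\dots,p_N$ and of a quantum comb: a state $\zeta_0$ of a finite-dimensional ancilla and the first slot's input, bipartite channels $\mathcal N_1,\dots,\mathcal N_{m-1}$ (the ancilla may change its dimension), and a POVM with outcomes $1,\dots,N$. Filling the slots with channels $\Phi_1,\dots,\Phi_m$, that is applying in this order $\mathrm{id}\otimes\Phi_1,\ \mathcal N_1,\ \mathrm{id}\otimes\Phi_2,\dots,\mathcal N_{m-1},\ \mathrm{id}\otimes\Phi_m$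 to $\zeta_0$ and measuring the POVM, yields outcome $j$ with a probability $\Xi_j[\Phi_1,\dots,\Phi_m]$; the success probability is $P_{\mathrm s}(\Phi_1,\dots,\Phi_m)=\sum_j p_j\,\Xi_j[\Phi_1,\dots,\Phi_m]$. For a non-empty coalition $T=\{k_1<\dots<k_m\}\subseteq S=\{1,\dots,M\}$ the utility is the maximal relative advantage $$\mathbf u(\Theta\mid T)=\max\frac{P_{\mathrm s}(\Theta,\dots,\Theta)-P_{\mathrm s}^{*}}{P_{\mathrm s}^{*}},\qquad P_{\mathrm s}^{*}=\max_{\Phi_i\in\mathcal F_{k_i}}P_{\mathrm s}(\Phi_1,\dots,\Phi_m),$$ over all games with $m=|T|$ slots and $P_{\mathrm s}^{*}>0$; $\mathbf u(\Theta\mid\emptyset)=0$. The Harsanyi dividend is defined recursively by $\mathbf d_{\mathbf u}(\Theta\mid T)=\mathbf u(\Theta\mid T)-\sum_{T'\subsetneq T}\mathbf d_{\mathbf u}(\Theta\mid T')$ if $|T|>1$, and $\mathbf d_{\mathbf u}(\Theta\mid T)=\mathbf u(\Theta\mid T)$ if $|T|\le1$. **Theorem.** Let $\Theta\in\mathcal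 D$ be a channel for which every $\mathcal R(\Theta\mid\mathcal F_k)$, $k=1,\dots,M$, is finite. Then all the minima and maxima in the definitions of $\mathcal R(\Theta\mid\mathcal F_k)$, of $P_{\mathrm s}^{*}$ (for every non-empty $T\subseteq S$ and every game with $|T|$ slots) and of $\mathbf u(\Theta\mid T)$ (for every non-empty $T\subseteq S$) are attained, and $$\mathbf d_{\mathbf u}(\Theta\mid S)=\prod_{k=1}^{M}\mathcal R(\Theta\mid\mathcal F_k)=\big[\mathcal G_{\mathcal R}(\Theta\mid\mathfrak C_{\mathcal F})\big]^{M},$$ where $\mathcal G_{\mathcal R}(\Theta\mid\mathfrak C_{\mathcal F})=\big(\prod_{k=1}^{M}\mathcal R(\Theta\mid\mathcal F_k)\big)^{1/M}$ is the geometric mean. -/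

import Mathlib

noncomputable section

namespace SRT

open scoped Matrix ComplexOrder

/-! ### Star-shaped sets, cones and fortresses in a real vector space -/

section Geometry

variable {V : Type*} [NormedAddCommGroup V] [NormedSpace ℝ V]

/-- The kernel of `K`: the set of all its centers. -/
def kernel (K : Set V) : Set V := {x | x ∈ K ∧ StarConvex ℝ x K}

/-- A star domain: a set with at least one center. -/
def IsStarDomain (K : Set V) : Prop := (kernel K).Nonempty

/-- A convex component of `K`: an inclusion-maximal convex subset of `K`. -/
def IsConvexComponent (K A : Set V) : Prop :=
  Maximal (fun B : Set V => B ⊆ K ∧ Convex ℝ B) A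

/-- The exterior of `A`: the complement of its interior. -/
def exterior (A : Set V) : Set V := (interior A)ᶜ

variable (V) in
/-- A convex cone with a (not necessarily zero) apex. -/
structure ApexCone where
  carrier : Set V
  apex : V
  convex : Convex ℝ carrier
  cone : ∀ v ∈ carrier, ∀ t : ℝ, 0 < t → apex + t • (v - apex) ∈ carrier

/-- The reflected cone: same apex, opposite directions. -/
def ApexCone.refl (C : ApexCone V) : Set V :=
  {w | ∃ v ∈ C.carrier, w = C.apex - (v - C.apex)}

/-- A fortress for `K`. -/
structure IsFortress (K : Set V) (T : Set (ApexCone V)) : Prop where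
  covering : K ∪ ⋃ C ∈ T, C.carrier = Set.univ
  outside : ∀ C ∈ T, K ⊆ exterior C.carrier
  reflected : ∀ C ∈ T, kernel K ⊆ C.refl
  boundary : frontier K = ⋃ C ∈ T, C.carrier ∩ K
  touching : ∀ C ∈ T, (C.carrier ∩ K).Nonempty

/-- `J` is inclusion-maximal among the intersections of the convex components of `K` with `C`. -/
def IsMaximalTrace (K C J : Set V) : Prop :=
  Maximal (fun B : Set V => ∃ A, IsConvexComponent K A ∧ A ∩ C = B) J

/-- The free section belonging to the maximal intersection `J`: the intersection of all the convex
components of `K` that meet `C` exactly in `J`. -/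
def sectionOf (K C J : Set V) : Set V := ⋂₀ {A | IsConvexComponent K A ∧ A ∩ C = J}

/-- The collection of free sections of `K` selected by `C`. -/
def freeSections (K C : Set V) : Set (Set V) := {A | ∃ J, IsMaximalTrace K C J ∧ A = sectionOf K C J}

end Geometry

/-! ### Quantum channels -/

section Channels

/-- Linear maps taking operators on `ℂ^n` to operators on `ℂ^m`. -/
abbrev SuperOp (n m : Type) : Type := Matrix n n ℂ →ₗ[ℂ] Matrix m m ℂ

/-- The map `id ⊗ Φ`, with an ancilla `A` on which the identity acts. -/
def ampliation (A : Type) {n m : Type} (Φ : SuperOp n m) (X : Matrix (A × n) (A × n) ℂ) :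
    Matrix (A × m) (A × m) ℂ :=
  fun x y => Φ (fun i j => X (x.1, i) (y.1, j)) x.2 y.2

/-- Density operators. -/
def IsState {n : Type} [Fintype n] (ρ : Matrix n n ℂ) : Prop := ρ.PosSemidef ∧ ρ.trace = 1

/-- Completely positive trace preserving maps. -/
structure IsChannel {n m : Type} [Fintype n] [Fintype m] (Φ : SuperOp n m) : Prop where
  completelyPositive : ∀ (a : ℕ) (X : Matrix (Fin a × n) (Fin a × n) ℂ),
    X.PosSemidef → (ampliation (Fin a) Φ X).PosSemidef
  tracePreserving : ∀ X : Matrix n n ℂ, (Φ X).trace = X.trace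

/-- The channels of a `d`-level system: the objects of the resource theory. -/
def channels (d : ℕ) : Set (SuperOp (Fin d) (Fin d)) := {Φ | IsChannel Φ}

/-- The `r ≥ 0` for which some mixture `(Θ + r Λ) / (1 + r)` with a channel `Λ` lies in `𝓧`. -/
def robustnessSet {d : ℕ} (Θ : SuperOp (Fin d) (Fin d)) (𝓧 : Set (SuperOp (Fin d) (Fin d))) :
    Set ℝ :=
  {r | 0 ≤ r ∧ ∃ Λ ∈ channels d, (1 + r)⁻¹ • (Θ + r • Λ) ∈ 𝓧}

/-- The generalised robustness of `Θ` with respect to `𝓧`. -/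
def robustness {d : ℕ} (Θ : SuperOp (Fin d) (Fin d)) (𝓧 : Set (SuperOp (Fin d) (Fin d))) : ℝ :=
  sInf (robustnessSet Θ 𝓧)

end Channels

/-! ### Comb-discrimination games -/

section Games

/-- A POVM with outcomes `0, …, N - 1` on the operators indexed by `n`. -/
structure POVM (n : Type) [Fintype n] [DecidableEq n] (N : ℕ) where
  effect : Fin N → Matrix n n ℂ
  posSemidef : ∀ j, (effect j).PosSemidef
  sum_eq_one : ∑ j, effect j = 1

/-- The part of a comb that follows the preparation: `Circuit d N a m` acts on a state of an
`a`-dimensional ancilla and the `d`-dimensional input of its first open slot, and has `m` open slots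
(so `m ≥ 1`). Each slot is followed by a bipartite channel feeding the next one, the last slot by a
POVM with `N` outcomes. -/
inductive Circuit (d N : ℕ) : ℕ → ℕ → Type
  | measure {a : ℕ} (E : POVM (Fin a × Fin d) N) : Circuit d N a 1
  | gate {a b m : ℕ} (G : SuperOp (Fin a × Fin d) (Fin b × Fin d)) (hG : IsChannel G)
      (rest : Circuit d N b m) : Circuit d N a (m + 1)

/-- The probability of the outcome `j` when the slots are filled with `Φ 0, Φ 1, …` and the
prepared state is `ρ`. -/
def Circuit.prob {d N : ℕ} : {a m : ℕ} → Circuit d N a m → (Fin m → SuperOp (Fin d) (Fin d)) →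
    Matrix (Fin a × Fin d) (Fin a × Fin d) ℂ → Fin N → ℝ
  | a, _, .measure E, Φ, ρ, j => (E.effect j * ampliation (Fin a) (Φ 0) ρ).trace.re
  | a, _, .gate G _ rest, Φ, ρ, j =>
      rest.prob (fun k => Φ k.succ) (G (ampliation (Fin a) (Φ 0) ρ)) j

/-- A comb-discrimination game with `m` slots: probabilities `p j`, and a comb (prepared state,
bipartite channels, final POVM) whose outcome `j` identifies the branch `j`. -/
structure CombGame (d m : ℕ) where
  N : ℕ
  p : Fin N → ℝ
  p_nonneg : ∀ j, 0 ≤ p j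
  p_sum : ∑ j, p j = 1
  a : ℕ
  ζ : Matrix (Fin a × Fin d) (Fin a × Fin d) ℂ
  ζ_state : IsState ζ
  circuit : Circuit d N a m

/-- The branch `Ξ_j`, mapping `m` channels to a probability. -/
def CombGame.branch {d m : ℕ} (G : CombGame d m) (j : Fin G.N)
    (Φ : Fin m → SuperOp (Fin d) (Fin d)) : ℝ :=
  G.circuit.prob Φ G.ζ j

/-- The success probability with the channel `Φ k` in slot `k`. -/
def CombGame.success {d m : ℕ} (G : CombGame d m) (Φ : Fin m → SuperOp (Fin d) (Fin d)) : ℝ :=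
  ∑ j, G.p j * G.branch j Φ

/-- The success probabilities that players holding the sets `𝓕 k` can achieve. -/
def CombGame.freeSuccesses {d m : ℕ} (G : CombGame d m)
    (𝓕 : Fin m → Set (SuperOp (Fin d) (Fin d))) : Set ℝ :=
  {q | ∃ Φ : Fin m → SuperOp (Fin d) (Fin d), (∀ k, Φ k ∈ 𝓕 k) ∧ G.success Φ = q}

/-- The success probability of the best strategy of players holding the sets `𝓕 k`. -/
def CombGame.bestFree {d m : ℕ} (G : CombGame d m)
    (𝓕 : Fin m → Set (SuperOp (Fin d) (Fin d))) : ℝ :=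
  sSup (G.freeSuccesses 𝓕)

/-- The relative advantages of `Θ` in every slot over the best free strategy, over all the games
with `m` slots for which this quotient is defined. -/
def relativeAdvantages {d m : ℕ} (Θ : SuperOp (Fin d) (Fin d))
    (𝓕 : Fin m → Set (SuperOp (Fin d) (Fin d))) : Set ℝ :=
  {x | ∃ G : CombGame d m, 0 < G.bestFree 𝓕 ∧
    x = (G.success (fun _ => Θ) - G.bestFree 𝓕) / G.bestFree 𝓕}

/-- The free sets held by the players of the coalition `T`, in increasing order of the players. -/
def coalitionSets {d M : ℕ} (𝓕 : Fin M → Set (SuperOp (Fin d) (Fin d))) (T : Finset (Fin M)) :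
    Fin T.card → Set (SuperOp (Fin d) (Fin d)) :=
  fun i => 𝓕 (T.orderEmbOfFin rfl i)

/-- The utility of the coalition `T`: its maximal relative advantage in games with `|T|` slots. -/
def utility {d M : ℕ} (Θ : SuperOp (Fin d) (Fin d)) (𝓕 : Fin M → Set (SuperOp (Fin d) (Fin d)))
    (T : Finset (Fin M)) : ℝ :=
  if T = ∅ then 0 else sSup (relativeAdvantages Θ (coalitionSets 𝓕 T))

/-- The Harsanyi dividend of the coalition `T` in the cooperative game with utility `u`. -/
def dividend {ι : Type} [DecidableEq ι] (u : Finset ι → ℝ) (T : Finset ι) : ℝ :=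
  if 1 < T.card then u T - ∑ T' ∈ T.ssubsets.attach, dividend u T'.1 else u T
termination_by T.card
decreasing_by exact Finset.card_lt_card (Finset.mem_ssubsets.1 T'.2)

/-- The geometric mean. -/
def geomMean {M : ℕ} (x : Fin M → ℝ) : ℝ := (∏ k, x k) ^ ((M : ℝ)⁻¹)

end Games

/-! ### Star resource theories of channels -/

section Theories

/-- A star resource theory of the channels of a `d`-level system: a compact star domain of channels
in a linear real representation of dimension `D`, with a fortress. A linear real representation is
an affine map which is injective on the channels. -/
structure StarResourceTheory (d D : ℕ) where
  rep : SuperOp (Fin d) (Fin d) →ᵃ[ℝ] EuclideanSpace ℝ (Fin D)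
  rep_injOn : Set.InjOn rep (channels d)
  free : Set (EuclideanSpace ℝ (Fin D))
  free_subset : free ⊆ rep '' channels d
  free_compact : IsCompact free
  free_star : IsStarDomain free
  fortress : Set (ApexCone (EuclideanSpace ℝ (Fin D)))
  isFortress : IsFortress free fortress

variable {d D : ℕ} (𝒯 : StarResourceTheory d D)

/-- The free sections belonging to a cone. -/
def StarResourceTheory.sections (C : ApexCone (EuclideanSpace ℝ (Fin D))) :
    Set (Set (EuclideanSpace ℝ (Fin D))) :=
  freeSections 𝒯.free C.carrier

/-- The domain belonging to a cone: the cone together with its free sections. -/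
def StarResourceTheory.domain (C : ApexCone (EuclideanSpace ℝ (Fin D))) :
    Set (EuclideanSpace ℝ (Fin D)) :=
  C.carrier ∪ ⋃₀ 𝒯.sections C

/-- The channels represented by the points of `A`. -/
def StarResourceTheory.channelsIn (A : Set (EuclideanSpace ℝ (Fin D))) :
    Set (SuperOp (Fin d) (Fin d)) :=
  {Φ | Φ ∈ channels d ∧ 𝒯.rep Φ ∈ A}

end Theories

end SRT

end

/-! Write R_k for the robustness with respect to the k-th section. Everything rests on the formula
u(Θ|T) = ∏_{k∈T} (1 + R_k) − 1 for the utility. Expanded over subsets, its right side is the sum of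
∏_{k∈T'} R_k over the non-empty T' ⊆ T, so Möbius inversion gives the dividend ∏_{k∈T} R_k
(`dividend_eq_prod`).

Upper bound: an optimal decomposition provides a free Φ_k for which (1 + R_k) Φ_k − Θ is completely
positive. The rest of a circuit preserves positivity, so replacing Θ by Φ_k costs at most a factor 1
+ R_k per slot (`Circuit.prob_le`).

Sharpness: a free section is convex, being an intersection of convex components. Hahn–Banach
therefore yields a positive semidefinite W_k whose value on Θ is 1 + R_k times its positive maximum
over the section (`exists_witness`). One game multiplies these functionals: every slot receives a
maximally entangled state and is tested with a multiple of W_k, while a failure prepares a flag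
state that fails all later tests (`exists_combGame_success_eq_prod`). The players then optimise
their factors independently, and the quotient of success probabilities is ∏ (1 + R_k).

Attainment is compactness: the sections are closed, the Choi matrices of channels form a compact
set, and success probabilities are continuous. -/

noncomputable section

namespace SRT

open scoped Matrix ComplexOrder Kronecker

/-! ### Positive semidefinite matrices: bounds, support projections, positive functionals -/

section PosSemidef

variable {n : Type} [Fintype n]

/-- The real part of the quadratic form of a matrix. -/
def quadRe (X : Matrix n n ℂ) (v : n → ℂ) : ℝ := (star v ⬝ᵥ X *ᵥ v).re

lemma quadRe_add (X Y : Matrix n n ℂ) (v : n → ℂ) :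
    quadRe (X + Y) v = quadRe X v + quadRe Y v := by
  simp [quadRe, Matrix.add_mulVec]

lemma quadRe_smul (c : ℝ) (X : Matrix n n ℂ) (v : n → ℂ) :
    quadRe (c • X) v = c * quadRe X v := by
  simp [quadRe, Matrix.smul_mulVec]

lemma quadRe_neg (X : Matrix n n ℂ) (v : n → ℂ) : quadRe (-X) v = - quadRe X v := by
  simp [quadRe, Matrix.neg_mulVec]

lemma quadRe_sub (X Y : Matrix n n ℂ) (v : n → ℂ) :
    quadRe (X - Y) v = quadRe X v - quadRe Y v := by
  rw [sub_eq_add_neg, quadRe_add, quadRe_neg, sub_eq_add_neg]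

lemma quadRe_conjTranspose (X : Matrix n n ℂ) (v : n → ℂ) : quadRe Xᴴ v = quadRe X v := by
  have : star v ⬝ᵥ Xᴴ *ᵥ v = star (star v ⬝ᵥ X *ᵥ v) := by
    rw [← Matrix.star_dotProduct_star, star_star, Matrix.star_mulVec,
      Matrix.dotProduct_mulVec]
  rw [quadRe, this]
  exact Complex.conj_re _

open scoped MatrixOrder in
lemma _root_.Matrix.PosSemidef.exists_eq_conjTranspose_mul_self {X : Matrix n n ℂ}
    (hX : X.PosSemidef) : ∃ B : Matrix n n ℂ, X = Bᴴ * B := by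
  classical
  exact CStarAlgebra.nonneg_iff_eq_star_mul_self.mp hX.nonneg

lemma _root_.Matrix.PosSemidef.quadRe_nonneg {X : Matrix n n ℂ} (hX : X.PosSemidef) (v : n → ℂ) :
    0 ≤ quadRe X v :=
  (Complex.nonneg_iff.1 (hX.dotProduct_mulVec_nonneg v)).1

lemma posSemidef_of_quadRe {X : Matrix n n ℂ} (hX : X.IsHermitian) (h : ∀ v, 0 ≤ quadRe X v) :
    X.PosSemidef :=
  .of_dotProduct_mulVec_nonneg hX fun v =>
    Complex.nonneg_iff.2 ⟨h v, (hX.im_star_dotProduct_mulVec_self v).symm⟩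

/-- The squared Euclidean norm. -/
def normSq (v : n → ℂ) : ℝ := ∑ i, ‖v i‖ ^ 2

lemma normSq_nonneg (v : n → ℂ) : 0 ≤ normSq v := Finset.sum_nonneg fun _ _ => by positivity

lemma quadRe_one [DecidableEq n] (v : n → ℂ) : quadRe 1 v = normSq v := by
  simp only [quadRe, Matrix.one_mulVec, normSq, dotProduct, Complex.re_sum]
  refine Finset.sum_congr rfl fun i _ => ?_
  rw [Pi.star_apply, RCLike.star_def, Complex.conj_mul']
  norm_cast

lemma abs_quadRe_le (X : Matrix n n ℂ) (v : n → ℂ) :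
    |quadRe X v| ≤ (∑ i, ∑ j, ‖X i j‖) * normSq v := by
  have hle : ∀ i, ‖v i‖ ^ 2 ≤ normSq v := fun i =>
    Finset.single_le_sum (f := fun i => ‖v i‖ ^ 2) (fun _ _ => by positivity) (Finset.mem_univ i)
  calc |quadRe X v| ≤ ‖star v ⬝ᵥ X *ᵥ v‖ := Complex.abs_re_le_norm _
    _ ≤ ∑ i, ∑ j, ‖v i‖ * (‖X i j‖ * ‖v j‖) := by
        simp only [dotProduct, Matrix.mulVec, Finset.mul_sum]
        refine (norm_sum_le _ _).trans (Finset.sum_le_sum fun i _ => (norm_sum_le _ _).trans ?_)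
        exact Finset.sum_le_sum fun j _ => by simp
    _ ≤ _ := by
        rw [Finset.sum_mul]
        refine Finset.sum_le_sum fun i _ => ?_
        rw [Finset.sum_mul]
        refine Finset.sum_le_sum fun j _ => ?_
        have : ‖v i‖ * ‖v j‖ ≤ normSq v := by
          nlinarith [hle i, hle j, sq_nonneg (‖v i‖ - ‖v j‖)]
        nlinarith [norm_nonneg (X i j)]

/-- Turns a witness into an effect of a two-outcome measurement by rescaling. -/
lemma exists_one_sub_smul_posSemidef [DecidableEq n] {W : Matrix n n ℂ} (hW : W.PosSemidef) :
    ∃ ε : ℝ, 0 < ε ∧ (1 - ε • W).PosSemidef := by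
  set c := ∑ i, ∑ j, ‖W i j‖ with hc
  have hc0 : 0 ≤ c := Finset.sum_nonneg fun _ _ => Finset.sum_nonneg fun _ _ => norm_nonneg _
  refine ⟨(1 + c)⁻¹, by positivity, posSemidef_of_quadRe ?_ fun v => ?_⟩
  · exact Matrix.isHermitian_one.sub (hW.1.smul (IsSelfAdjoint.all _))
  · rw [quadRe_sub, quadRe_one, quadRe_smul]
    have h1 := (le_abs_self _).trans (abs_quadRe_le W v)
    have h2 := normSq_nonneg v
    rw [sub_nonneg, inv_mul_le_iff₀ (by positivity)]
    nlinarith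

/-- With X = BᴴB an entry is an inner product of two columns of B, and each squared column norm is
at most the trace. This bounds the Choi matrices of channels, whose trace is fixed. -/
lemma _root_.Matrix.PosSemidef.norm_apply_le {X : Matrix n n ℂ} (hX : X.PosSemidef) (i j : n) :
    ‖X i j‖ ≤ X.trace.re := by
  classical
  obtain ⟨B, rfl⟩ := hX.exists_eq_conjTranspose_mul_self
  have hle : ∀ i k, ‖B k i‖ ^ 2 ≤ ∑ k, ‖B k i‖ ^ 2 := fun i k =>
    Finset.single_le_sum (f := fun k => ‖B k i‖ ^ 2) (fun _ _ => by positivity) (Finset.mem_univ k)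
  have htr : (Bᴴ * B).trace.re = ∑ i, ∑ k, ‖B k i‖ ^ 2 := by
    simp only [Matrix.trace, Matrix.diag, Matrix.mul_apply, Complex.re_sum,
      Matrix.conjTranspose_apply, RCLike.star_def, Complex.conj_mul']
    norm_cast
  have hcol : ∀ i, ∑ k, ‖B k i‖ ^ 2 ≤ (Bᴴ * B).trace.re := fun i => by
    rw [htr]
    exact Finset.single_le_sum (f := fun i => ∑ k, ‖B k i‖ ^ 2)
      (fun _ _ => Finset.sum_nonneg fun _ _ => by positivity) (Finset.mem_univ i)
  calc ‖(Bᴴ * B) i j‖ ≤ ∑ k, ‖B k i‖ * ‖B k j‖ := by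
        rw [Matrix.mul_apply]
        exact (norm_sum_le _ _).trans (Finset.sum_le_sum fun k _ => by simp)
    _ ≤ ∑ k, (‖B k i‖ ^ 2 / 2 + ‖B k j‖ ^ 2 / 2) :=
        Finset.sum_le_sum fun k _ => by nlinarith [sq_nonneg (‖B k i‖ - ‖B k j‖)]
    _ ≤ _ := by
        rw [Finset.sum_add_distrib, ← Finset.sum_div, ← Finset.sum_div]
        linarith [hcol i, hcol j]

/-- A positive semidefinite matrix vanishes on the kernel of any larger one. -/
lemma _root_.Matrix.PosSemidef.mul_eq_zero_of_le {X Y : Matrix n n ℂ} {m : Type} [Fintype m]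
    {Q : Matrix n m ℂ}
    (hX : X.PosSemidef) (hXY : (Y - X).PosSemidef) (hY : Y * Q = 0) : X * Q = 0 := by
  classical
  -- Both QᴴXQ and its negative are positive semidefinite, so the trace vanishes.
  have h1 : Qᴴ * X * Q = 0 := by
    have h2 := hXY.conjTranspose_mul_mul_same Q
    rw [Matrix.mul_sub, Matrix.sub_mul, Matrix.mul_assoc, hY, Matrix.mul_zero, zero_sub] at h2
    have h3 := hX.conjTranspose_mul_mul_same Q
    refine h3.trace_eq_zero_iff.1 (le_antisymm ?_ h3.trace_nonneg)
    simpa using h2.trace_nonneg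
  obtain ⟨B, rfl⟩ := hX.exists_eq_conjTranspose_mul_self
  rw [← Matrix.mul_assoc, ← Matrix.conjTranspose_mul, Matrix.mul_assoc,
    Matrix.conjTranspose_mul_self_eq_zero] at h1
  rw [Matrix.mul_assoc, h1, Matrix.mul_zero]

/-- The support projection of a positive semidefinite matrix. -/
lemma _root_.Matrix.PosSemidef.exists_support [DecidableEq n] {J : Matrix n n ℂ}
    (hJ : J.PosSemidef) :
    ∃ P : Matrix n n ℂ, P.IsHermitian ∧ J * (1 - P) = 0 ∧
      ∃ ε : ℝ, 0 < ε ∧ ∀ v, ε * normSq (P *ᵥ v) ≤ quadRe J (P *ᵥ v) := by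
  set lam := hJ.1.eigenvalues
  set U : Matrix n n ℂ := (hJ.1.eigenvectorUnitary : Matrix n n ℂ)
  have hU1 : Uᴴ * U = 1 := Unitary.star_mul_self_of_mem hJ.1.eigenvectorUnitary.2
  have hU2 : U * Uᴴ = 1 := Unitary.mul_star_self_of_mem hJ.1.eigenvectorUnitary.2
  have hJs : J = U * Matrix.diagonal (fun i => (lam i : ℂ)) * Uᴴ := hJ.1.spectral_theorem
  have hpos : ∀ i, 0 ≤ lam i := hJ.eigenvalues_nonneg
  -- Zero eigenvalues are replaced by 1, so that the minimum is positive and bounds the nonzero ones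
  -- from below.
  obtain ⟨ε, hε, hεle⟩ : ∃ ε : ℝ, 0 < ε ∧ ∀ i, lam i ≠ 0 → ε ≤ lam i := by
    obtain h | h := isEmpty_or_nonempty n
    · exact ⟨1, one_pos, fun i => h.elim i⟩
    · obtain ⟨i, hi⟩ := Finite.exists_min fun i => if lam i = 0 then 1 else lam i
      refine ⟨_, ?_, fun j hj => (hi j).trans_eq (if_neg hj)⟩
      split_ifs with h0
      · exact one_pos
      · exact lt_of_le_of_ne (hpos i) (Ne.symm h0)
  set e : n → ℂ := fun i => if lam i = 0 then 0 else 1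
  have hmul : ∀ a b : n → ℂ, U * Matrix.diagonal a * Uᴴ * (U * Matrix.diagonal b * Uᴴ) =
      U * Matrix.diagonal (fun i => a i * b i) * Uᴴ := fun a b => by
    rw [← Matrix.diagonal_mul_diagonal]
    simp only [Matrix.mul_assoc]
    rw [← Matrix.mul_assoc Uᴴ U, hU1, Matrix.one_mul]
  have hPP : U * Matrix.diagonal e * Uᴴ * (U * Matrix.diagonal e * Uᴴ) =
      U * Matrix.diagonal e * Uᴴ := by
    rw [hmul]; congr 3; funext i; simp only [e]; split_ifs <;> simp
  have hPH : (U * Matrix.diagonal e * Uᴴ).IsHermitian := by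
    refine Matrix.isHermitian_mul_mul_conjTranspose U ?_
    refine Matrix.isHermitian_diagonal_of_self_adjoint _ ?_
    funext i; simp only [e, Pi.star_apply]; split_ifs <;> simp
  refine ⟨U * Matrix.diagonal e * Uᴴ, hPH, ?_, ε, hε, fun v => ?_⟩
  · rw [Matrix.mul_sub, Matrix.mul_one, hJs, hmul, sub_eq_zero]
    congr 3; funext i; simp only [e]; split_ifs with h <;> simp [h]
  · have h1 : (J - ε • (U * Matrix.diagonal e * Uᴴ)).PosSemidef := by
      have : J - ε • (U * Matrix.diagonal e * Uᴴ) =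
          U * Matrix.diagonal (fun i => (lam i : ℂ) - ε • e i) * Uᴴ := by
        rw [← Matrix.diagonal_sub, Matrix.mul_sub, Matrix.sub_mul, ← hJs]
        congr 1
        rw [show (Matrix.diagonal fun i => ε • e i) = ε • Matrix.diagonal e from
          Matrix.diagonal_smul ε e, Matrix.mul_smul, Matrix.smul_mul]
      rw [this]
      refine Matrix.PosSemidef.mul_mul_conjTranspose_same (.diagonal fun i => ?_) U
      simp only [e, Pi.zero_apply]
      split_ifs with h
      · simp [h]
      · have := hεle i h
        simpa using mod_cast this
    have h2 := h1.quadRe_nonneg ((U * Matrix.diagonal e * Uᴴ) *ᵥ v)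
    rw [quadRe_sub, quadRe_smul, sub_nonneg] at h2
    convert h2 using 2
    rw [← quadRe_one]
    simp only [quadRe, Matrix.mulVec_mulVec, Matrix.one_mul, hPP]

/-- A positive functional is given by a positive semidefinite matrix. -/
lemma exists_posSemidef_of_nonneg [DecidableEq n] (f : Matrix n n ℂ →ₗ[ℝ] ℝ)
    (hf : ∀ X, (∀ v, 0 ≤ quadRe X v) → 0 ≤ f X) :
    ∃ W : Matrix n n ℂ, W.PosSemidef ∧ ∀ X, f X = (W * X).trace.re := by
  -- Positivity is assumed on all matrices with nonnegative real quadratic form, not only Hermitian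
  -- ones. Skew-Hermitian parts have zero form, so `f` kills them; this makes `W` Hermitian.
  have hskew : ∀ X Y : Matrix n n ℂ, Y = -Xᴴ → f (X + Y) = 0 := by
    rintro X _ rfl
    have hq : ∀ v, quadRe (X + -Xᴴ) v = 0 := fun v => by
      rw [quadRe_add, quadRe_neg, quadRe_conjTranspose]; ring
    refine le_antisymm ?_ (hf _ fun v => (hq v).ge)
    have := hf (-(X + -Xᴴ)) fun v => by rw [quadRe_neg, hq]; simp
    rwa [map_neg, neg_nonneg] at this
  -- The entries encode the values of the real-linear `f` on the real basis of matrix units and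
  -- their multiples by the imaginary unit.
  let W : Matrix n n ℂ := Matrix.of fun j i =>
    (f (Matrix.single i j 1) : ℂ) - f (Matrix.single i j Complex.I) * Complex.I
  have hW : ∀ X, f X = (W * X).trace.re := fun X => by
    conv_lhs => rw [Matrix.matrix_eq_sum_single X]
    simp only [map_sum, Matrix.trace, Matrix.diag, Matrix.mul_apply, Complex.re_sum]
    rw [Finset.sum_comm]
    refine Finset.sum_congr rfl fun j _ => Finset.sum_congr rfl fun i _ => ?_
    have : Matrix.single i j (X i j) = (X i j).re • Matrix.single i j (1 : ℂ) +
        (X i j).im • Matrix.single i j Complex.I := by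
      rw [Matrix.smul_single, Matrix.smul_single, ← Matrix.single_add]
      congr 1
      simp [Complex.re_add_im]
    rw [this, map_add, map_smul, map_smul]
    simp [W]
    ring
  refine ⟨W, posSemidef_of_quadRe ?_ fun v => ?_, hW⟩
  · ext j i
    have h1 := hskew (Matrix.single i j 1) (-Matrix.single j i 1) (by simp)
    have h2 := hskew (Matrix.single i j Complex.I) (Matrix.single j i Complex.I)
      (by simp [← Matrix.single_neg])
    rw [map_add] at h1 h2
    rw [map_neg] at h1
    apply Complex.ext <;> simp [W] <;> linarith
  · have h1 : quadRe W v = f (Matrix.vecMulVec v (star v)) := by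
      rw [hW, Matrix.mul_vecMulVec, Matrix.trace_vecMulVec, dotProduct_comm]; rfl
    rw [h1]
    exact hf _ fun w => (Matrix.posSemidef_vecMulVec_self_star v).quadRe_nonneg w

end PosSemidef

/-! ### Choi matrices and complete positivity -/

section Choi

variable {n m : Type}

lemma ampliation_smul_left {A : Type} (c : ℝ) (Φ : SuperOp n m) (X : Matrix (A × n) (A × n) ℂ) :
    ampliation A (c • Φ) X = c • ampliation A Φ X := rfl

lemma ampliation_sub_left {A : Type} (Φ Ψ : SuperOp n m) (X : Matrix (A × n) (A × n) ℂ) :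
    ampliation A (Φ - Ψ) X = ampliation A Φ X - ampliation A Ψ X := rfl

variable [Fintype n] [DecidableEq n]

/-- The Choi matrix of a superoperator, as a linear equivalence. -/
def choi : SuperOp n m ≃ₗ[ℂ] Matrix (n × m) (n × m) ℂ where
  toFun Φ := Matrix.of fun x y => Φ (Matrix.single x.1 y.1 1) x.2 y.2
  map_add' _ _ := rfl
  map_smul' _ _ := rfl
  invFun X :=
    { toFun := fun Y => Matrix.of fun k l => ∑ i, ∑ j, Y i j * X (i, k) (j, l)
      map_add' := fun Y Z => by
        ext k l
        simp [add_mul, Finset.sum_add_distrib]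
      map_smul' := fun c Y => by
        ext k l
        simp [Finset.mul_sum, mul_assoc] }
  left_inv Φ := by
    ext Y k l
    simp only [Matrix.of_apply, LinearMap.coe_mk, AddHom.coe_mk]
    conv_rhs => rw [Matrix.matrix_eq_sum_single Y]
    simp only [map_sum, Matrix.sum_apply]
    refine Finset.sum_congr rfl fun i _ => Finset.sum_congr rfl fun j _ => ?_
    have : Matrix.single i j (Y i j) = Y i j • Matrix.single i j (1 : ℂ) := by
      rw [Matrix.smul_single, smul_eq_mul, mul_one]
    rw [this, map_smul]
    rfl
  right_inv X := by
    ext x y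
    simp [Matrix.single_apply, ite_and]

lemma choi_apply (Φ : SuperOp n m) (x y : n × m) :
    choi Φ x y = Φ (Matrix.single x.1 y.1 1) x.2 y.2 := rfl

lemma apply_eq_sum_choi (Φ : SuperOp n m) (Y : Matrix n n ℂ) (k l : m) :
    Φ Y k l = ∑ i, ∑ j, Y i j * choi Φ (i, k) (j, l) := by
  conv_lhs => rw [← choi.symm_apply_apply Φ]
  rfl

lemma ampliation_apply_eq_sum {A : Type} (Φ : SuperOp n m) (X : Matrix (A × n) (A × n) ℂ)
    (x y : A × m) :
    ampliation A Φ X x y = ∑ i, ∑ j, X (x.1, i) (y.1, j) * choi Φ (i, x.2) (j, y.2) :=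
  apply_eq_sum_choi _ _ _ _

/-- The ampliation as a linear map. -/
def ampliationₗ (A : Type) (Φ : SuperOp n m) : SuperOp (A × n) (A × m) where
  toFun := ampliation A Φ
  map_add' X Y := by
    ext x y
    simp only [ampliation_apply_eq_sum, Matrix.add_apply, add_mul, Finset.sum_add_distrib]
  map_smul' c X := by
    ext x y
    simp only [ampliation_apply_eq_sum, Matrix.smul_apply, smul_eq_mul, mul_assoc, Finset.mul_sum,
      RingHom.id_apply]

variable [Fintype m]

/-- A superoperator with a positive semidefinite Choi matrix is completely positive. -/
lemma posSemidef_ampliation {A : Type} [Fintype A] [DecidableEq A] {Φ : SuperOp n m}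
    (hΦ : (choi Φ).PosSemidef)
    {X : Matrix (A × n) (A × n) ℂ} (hX : X.PosSemidef) : (ampliation A Φ X).PosSemidef := by
  classical
  -- `B` contracts the system index of X with the input index of the Choi matrix, so the ampliation
  -- is a congruence of X ⊗ `choi Φ`.
  let B : Matrix ((A × n) × (n × m)) (A × m) ℂ := Matrix.of fun p q =>
    if p.1.1 = q.1 then if p.1.2 = p.2.1 then if p.2.2 = q.2 then 1 else 0 else 0 else 0
  have h : ampliation A Φ X = Bᴴ * (X ⊗ₖ choi Φ) * B := by
    ext x y
    simp only [ampliation_apply_eq_sum, Matrix.mul_apply, B, Matrix.conjTranspose_apply,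
      Matrix.of_apply, Fintype.sum_prod_type, Matrix.kroneckerMap_apply, apply_ite star, star_one,
      star_zero, ite_mul, mul_ite, zero_mul, mul_zero, one_mul, mul_one]
    simp only [Finset.sum_ite_eq, Finset.sum_ite_eq', Finset.mem_univ, if_true, Finset.sum_ite_irrel,
      Finset.sum_const_zero]
    rw [Finset.sum_comm]
  rw [h]
  exact (hX.kronecker hΦ).conjTranspose_mul_mul_same B

lemma trace_apply_eq_sum_choi (Φ : SuperOp n m) (Y : Matrix n n ℂ) :
    (Φ Y).trace = ∑ i, ∑ j, Y i j * ∑ k, choi Φ (i, k) (j, k) := by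
  simp only [Matrix.trace, Matrix.diag, apply_eq_sum_choi, Finset.mul_sum]
  rw [Finset.sum_comm]
  exact Finset.sum_congr rfl fun i _ => Finset.sum_comm

lemma tracePreserving_iff (Φ : SuperOp n m) :
    (∀ Y, (Φ Y).trace = Y.trace) ↔
      ∀ i j, ∑ k, choi Φ (i, k) (j, k) = if i = j then 1 else 0 := by
  constructor
  · intro h i j
    have := h (Matrix.single i j 1)
    rw [trace_apply_eq_sum_choi] at this
    simp only [Matrix.single_apply, ite_and, ite_mul, one_mul, zero_mul, Finset.sum_ite_eq,
      Finset.mem_univ, if_true, Finset.sum_ite_irrel, Finset.sum_const_zero] at this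
    rw [this]
    split_ifs with hij
    · rw [hij, Matrix.trace_single_eq_same]
    · exact Matrix.trace_single_eq_of_ne _ _ _ hij
  · intro h Y
    rw [trace_apply_eq_sum_choi]
    simp [h, Matrix.trace]

end Choi

/-! ### Channels in terms of their Choi matrices; compactness -/

section ChoiChannels

variable {d : ℕ}

/-- The Choi matrix is the image of the unnormalised maximally entangled projector under the
ampliation with a d-dimensional ancilla. -/
lemma IsChannel.posSemidef_choi {m : Type} [Fintype m] {Φ : SuperOp (Fin d) m} (h : IsChannel Φ) :
    (choi Φ).PosSemidef := by
  let v : Fin d × Fin d → ℂ := fun x => if x.1 = x.2 then 1 else 0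
  convert h.completelyPositive d _ (Matrix.posSemidef_vecMulVec_self_star v) using 1
  ext x y
  simp only [choi_apply, ampliation]
  refine congrArg (fun Y => Φ Y x.2 y.2) ?_
  ext i j
  simp only [v, Matrix.single_apply, Matrix.vecMulVec_apply, Pi.star_apply]
  split_ifs <;> simp_all

lemma isChannel_iff_choi {Φ : SuperOp (Fin d) (Fin d)} :
    IsChannel Φ ↔ (choi Φ).PosSemidef ∧
      ∀ i j, ∑ k, choi Φ (i, k) (j, k) = if i = j then 1 else 0 :=
  ⟨fun h => ⟨h.posSemidef_choi, (tracePreserving_iff Φ).1 h.tracePreserving⟩,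
    fun h => ⟨fun _ _ hX => posSemidef_ampliation h.1 hX, (tracePreserving_iff Φ).2 h.2⟩⟩

lemma IsChannel.map_posSemidef {n m : Type} [Fintype n] [Fintype m] {Φ : SuperOp n m}
    (h : IsChannel Φ) {X : Matrix n n ℂ} (hX : X.PosSemidef) : (Φ X).PosSemidef :=
  (h.completelyPositive 1 _ (hX.submatrix Prod.snd)).submatrix fun k => ((0 : Fin 1), k)

lemma IsChannel.trace_choi {Φ : SuperOp (Fin d) (Fin d)} (h : IsChannel Φ) :
    (choi Φ).trace = d := by
  rw [Matrix.trace, Fintype.sum_prod_type]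
  simp [(isChannel_iff_choi.1 h).2]

lemma convex_channels : Convex ℝ (channels d) := by
  intro Φ hΦ Ψ hΨ a b ha hb hab
  refine ⟨fun c X hX => ?_, fun X => ?_⟩
  · exact ((hΦ.completelyPositive c X hX).smul ha).add ((hΨ.completelyPositive c X hX).smul hb)
  · rw [LinearMap.add_apply, LinearMap.smul_apply, LinearMap.smul_apply, Matrix.trace_add,
      Matrix.trace_smul, Matrix.trace_smul, hΦ.tracePreserving, hΨ.tracePreserving, ← add_smul, hab,
      one_smul]

lemma isClosed_posSemidef {n : Type} [Fintype n] :
    IsClosed {X : Matrix n n ℂ | X.PosSemidef} := by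
  simp only [Matrix.posSemidef_iff_dotProduct_mulVec, Set.ofPred_and, Set.ofPred_forall]
  refine IsClosed.inter ?_ (isClosed_iInter fun v => ?_)
  · exact isClosed_eq continuous_id.matrix_conjTranspose continuous_id
  · refine (isClosed_Ici (a := (0 : ℂ))).preimage ?_
    exact continuous_const.dotProduct (continuous_id.matrix_mulVec continuous_const)

/-- Positivity and trace preservation are closed conditions, and the trace d bounds every entry. -/
lemma isCompact_choi_channels : IsCompact (choi '' channels d) := by
  have heq : choi '' channels d = {X | X.PosSemidef} ∩
      ⋂ i : Fin d, ⋂ j : Fin d, {X : Matrix (Fin d × Fin d) (Fin d × Fin d) ℂ |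
        ∑ k, X (i, k) (j, k) = if i = j then 1 else 0} := by
    ext X
    rw [LinearEquiv.image_eq_preimage_symm]
    simp [channels, isChannel_iff_choi]
  refine IsCompact.of_isClosed_subset
    ((isCompact_closedBall (0 : ℂ) d).matrix (m := Fin d × Fin d) (n := Fin d × Fin d)) ?_ ?_
  · rw [heq]
    refine isClosed_posSemidef.inter (isClosed_iInter fun i => isClosed_iInter fun j => ?_)
    exact isClosed_eq (continuous_finsetSum _ fun k _ => continuous_id.matrix_elem _ _)
      continuous_const
  · rintro _ ⟨Φ, hΦ, rfl⟩ i j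
    have := hΦ.posSemidef_choi.norm_apply_le i j
    rw [hΦ.trace_choi] at this
    simpa using this

end ChoiChannels

/-! ### Free sections: closedness, convexity, existence -/

section Sections

variable {V : Type*} [NormedAddCommGroup V] [NormedSpace ℝ V]

/-- The closure is again a convex subset of `K`, so maximality applies. -/
lemma IsConvexComponent.isClosed {K A : Set V} (hK : IsClosed K) (hA : IsConvexComponent K A) :
    IsClosed A := by
  have h : closure A ⊆ A :=
    hA.le_of_ge ⟨closure_minimal hA.prop.1 hK, hA.prop.2.closure⟩ subset_closure
  exact isClosed_of_closure_subset h

lemma isClosed_of_mem_freeSections {K C A : Set V} (hK : IsClosed K) (hA : A ∈ freeSections K C) :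
    IsClosed A := by
  obtain ⟨J, -, rfl⟩ := hA
  exact isClosed_sInter fun B hB => hB.1.isClosed hK

lemma convex_of_mem_freeSections {K C A : Set V} (hA : A ∈ freeSections K C) : Convex ℝ A := by
  obtain ⟨J, -, rfl⟩ := hA
  exact convex_sInter fun B hB => hB.1.prop.2

lemma convex_sUnion_of_isChain {c : Set (Set V)} (hc : IsChain (· ⊆ ·) c)
    (h : ∀ A ∈ c, Convex ℝ A) : Convex ℝ (⋃₀ c) :=
  DirectedOn.convex_sUnion hc.directedOn fun A hA => h A hA

lemma exists_isConvexComponent_superset {K B : Set V} (hB : B ⊆ K) (hBc : Convex ℝ B) :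
    ∃ A, B ⊆ A ∧ IsConvexComponent K A := by
  refine zorn_subset_nonempty {B : Set V | B ⊆ K ∧ Convex ℝ B} (fun c hc hch _ => ?_) B ⟨hB, hBc⟩
  exact ⟨⋃₀ c, ⟨Set.sUnion_subset fun A hA => (hc hA).1,
    convex_sUnion_of_isChain hch fun A hA => (hc hA).2⟩, fun A hA => Set.subset_sUnion_of_mem hA⟩

/-- Zorn on the traces on `C`: since `C` is convex, the union of a chain of traces is a convex
subset of `K`, and the trace of any component containing it bounds the chain. -/
lemma freeSections_nonempty {K C : Set V} (hC : Convex ℝ C) : (freeSections K C).Nonempty := by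
  obtain ⟨J, hJ⟩ := zorn_subset {B : Set V | ∃ A, IsConvexComponent K A ∧ A ∩ C = B}
    fun c hc hch => by
      obtain ⟨A, hA, hAc⟩ := exists_isConvexComponent_superset (K := K) (B := ⋃₀ c)
        (Set.sUnion_subset fun B hB => by
          obtain ⟨A, hA, rfl⟩ := hc hB
          exact Set.inter_subset_left.trans hA.prop.1)
        (convex_sUnion_of_isChain hch fun B hB => by
          obtain ⟨A, hA, rfl⟩ := hc hB
          exact hA.prop.2.inter hC)
      refine ⟨A ∩ C, ⟨A, hAc, rfl⟩, fun B hB => Set.subset_inter ?_ ?_⟩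
      · exact (Set.subset_sUnion_of_mem hB).trans hA
      · obtain ⟨A, -, rfl⟩ := hc hB
        exact Set.inter_subset_right
  exact ⟨_, J, hJ, rfl⟩

end Sections

/-! ### The sets of free channels as subsets of operator space -/

section ChannelsIn

variable {d D : ℕ} (𝒯 : StarResourceTheory d D)

/-- An affine map on a finite-dimensional space is continuous, so the section pulls back to a closed
part of the compact set of channels. -/
lemma StarResourceTheory.isCompact_choi_channelsIn {A : Set (EuclideanSpace ℝ (Fin D))}
    (hA : IsClosed A) : IsCompact (choi '' 𝒯.channelsIn A) := by
  let g : Matrix (Fin d × Fin d) (Fin d × Fin d) ℂ →ᵃ[ℝ] EuclideanSpace ℝ (Fin D) :=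
    𝒯.rep.comp (choi.symm.toLinearMap.restrictScalars ℝ).toAffineMap
  have hg : Continuous g := by
    rw [g.decomp]
    exact (LinearMap.continuous_of_finiteDimensional g.linear).add continuous_const
  have heq : choi '' 𝒯.channelsIn A = choi '' channels d ∩ g ⁻¹' A := by
    ext X
    rw [LinearEquiv.image_eq_preimage_symm, LinearEquiv.image_eq_preimage_symm]
    rfl
  rw [heq]
  exact isCompact_choi_channels.inter_right (hA.preimage hg)

lemma StarResourceTheory.convex_channelsIn {A : Set (EuclideanSpace ℝ (Fin D))}
    (hA : Convex ℝ A) : Convex ℝ (𝒯.channelsIn A) :=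
  convex_channels.inter (hA.affine_preimage 𝒯.rep)

end ChannelsIn

/-! ### Attainment of the robustness and of the best free success probability -/

section Attained

variable {d : ℕ}

lemma isLeast_robustness {Θ : SuperOp (Fin d) (Fin d)} {𝓧 : Set (SuperOp (Fin d) (Fin d))}
    (h𝓧 : IsCompact (choi '' 𝓧)) (hne : (robustnessSet Θ 𝓧).Nonempty) :
    IsLeast (robustnessSet Θ 𝓧) (robustness Θ 𝓧) := by
  obtain ⟨r₀, hr₀⟩ := hne
  -- Capping r by one feasible value makes the set of admissible pairs (r, Λ) compact; its
  -- projection is the capped robustness set.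
  let S : Set (ℝ × Matrix (Fin d × Fin d) (Fin d × Fin d) ℂ) :=
    (Set.Icc 0 r₀ ×ˢ (choi '' channels d)) ∩
      (fun p => (1 + p.1)⁻¹ • (choi Θ + p.1 • p.2)) ⁻¹' (choi '' 𝓧)
  have hS : IsCompact S := by
    have hK : IsCompact (Set.Icc 0 r₀ ×ˢ (choi '' channels d)) :=
      isCompact_Icc.prod isCompact_choi_channels
    refine hK.of_isClosed_subset ?_ Set.inter_subset_left
    refine ContinuousOn.preimage_isClosed_of_isClosed ?_ hK.isClosed h𝓧.isClosed
    have h1 : Continuous fun p : ℝ × Matrix (Fin d × Fin d) (Fin d × Fin d) ℂ => 1 + p.1 :=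
      continuous_const.add continuous_fst
    have h2 : Continuous fun p : ℝ × Matrix (Fin d × Fin d) (Fin d × Fin d) ℂ =>
        choi Θ + p.1 • p.2 := continuous_const.add (continuous_fst.smul continuous_snd)
    refine ContinuousOn.smul (h1.continuousOn.inv₀ fun p hp => ?_) h2.continuousOn
    have := hp.1.1
    positivity
  have himg : Prod.fst '' S = robustnessSet Θ 𝓧 ∩ Set.Iic r₀ := by
    ext r
    constructor
    · rintro ⟨⟨r, _⟩, ⟨⟨hr, Λ, hΛ, rfl⟩, Φ, hΦ, hΦeq⟩, rfl⟩
      refine ⟨⟨hr.1, Λ, hΛ, ?_⟩, hr.2⟩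
      convert hΦ
      apply choi.injective
      rw [hΦeq]
      rfl
    · rintro ⟨⟨hr, Λ, hΛ, h⟩, hr'⟩
      exact ⟨(r, choi Λ), ⟨⟨⟨hr, hr'⟩, Λ, hΛ, rfl⟩, _, h, rfl⟩, rfl⟩
  have hcomp : IsCompact (robustnessSet Θ 𝓧 ∩ Set.Iic r₀) := himg ▸ hS.image continuous_fst
  obtain ⟨r, hr, hle⟩ := hcomp.exists_isLeast ⟨r₀, hr₀, Set.mem_Iic.2 le_rfl⟩
  have hleast : IsLeast (robustnessSet Θ 𝓧) r :=
    ⟨hr.1, fun s hs => (le_total s r₀).elim (fun h => hle ⟨hs, h⟩) fun h => le_trans hr.2 h⟩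
  rwa [robustness, hleast.csInf_eq]

lemma Circuit.prob_measure {N a : ℕ} (E : POVM (Fin a × Fin d) N)
    (Φ : Fin 1 → SuperOp (Fin d) (Fin d)) (ρ : Matrix (Fin a × Fin d) (Fin a × Fin d) ℂ)
    (j : Fin N) :
    (Circuit.measure E).prob Φ ρ j = (E.effect j * ampliation (Fin a) (Φ 0) ρ).trace.re := rfl

lemma Circuit.prob_gate {N a b m : ℕ} (G : SuperOp (Fin a × Fin d) (Fin b × Fin d))
    (hG : IsChannel G) (c : Circuit d N b m) (Φ : Fin (m + 1) → SuperOp (Fin d) (Fin d))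
    (ρ : Matrix (Fin a × Fin d) (Fin a × Fin d) ℂ) (j : Fin N) :
    (Circuit.gate G hG c).prob Φ ρ j =
      c.prob (fun k => Φ k.succ) (G (ampliation (Fin a) (Φ 0) ρ)) j := rfl

/-- Continuity is joint in the channels and the input, because a gate passes to the rest of the
circuit an input that depends on the first channel. -/
lemma Circuit.continuous_prob {N a m : ℕ} (c : Circuit d N a m) (j : Fin N) :
    Continuous fun p : (Fin m → Matrix (Fin d × Fin d) (Fin d × Fin d) ℂ) ×
      Matrix (Fin a × Fin d) (Fin a × Fin d) ℂ => c.prob (fun k => choi.symm (p.1 k)) p.2 j := by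
  have hamp : ∀ (a m : ℕ), Continuous fun p : (Fin (m + 1) →
      Matrix (Fin d × Fin d) (Fin d × Fin d) ℂ) × Matrix (Fin a × Fin d) (Fin a × Fin d) ℂ =>
      ampliation (Fin a) (choi.symm (p.1 0)) p.2 := fun a m => by
    refine continuous_matrix fun x y => ?_
    simp only [ampliation_apply_eq_sum, LinearEquiv.apply_symm_apply]
    refine continuous_finsetSum _ fun i _ => continuous_finsetSum _ fun j _ => ?_
    exact (continuous_snd.matrix_elem _ _).mul
      (((continuous_apply 0).comp continuous_fst).matrix_elem _ _)
  induction c with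
  | @measure a E =>
    simp only [Circuit.prob_measure]
    have h1 := (continuous_const (y := E.effect j)).matrix_mul (hamp a 0)
    have h2 := h1.matrix_trace
    exact Complex.continuous_re.comp h2
  | @gate a b m G hG rest ih =>
    simp only [Circuit.prob_gate]
    have hGc : Continuous G := (G.restrictScalars ℝ).continuous_of_finiteDimensional
    have h1 : Continuous fun p : (Fin (m + 1) → Matrix (Fin d × Fin d) (Fin d × Fin d) ℂ) ×
        Matrix (Fin a × Fin d) (Fin a × Fin d) ℂ => fun k : Fin m => p.1 k.succ :=
      continuous_pi fun k => (continuous_apply k.succ).comp continuous_fst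
    have h2 := hGc.comp (hamp a m)
    have h3 := ih.comp (h1.prodMk h2)
    exact h3

lemma CombGame.isGreatest_bestFree {m : ℕ} (G : CombGame d m)
    {𝓧 : Fin m → Set (SuperOp (Fin d) (Fin d))} (h𝓧 : ∀ k, IsCompact (choi '' 𝓧 k))
    (hne : ∀ k, (𝓧 k).Nonempty) :
    IsGreatest (G.freeSuccesses 𝓧) (G.bestFree 𝓧) := by
  have hcont : Continuous fun X : Fin m → Matrix (Fin d × Fin d) (Fin d × Fin d) ℂ =>
      G.success fun k => choi.symm (X k) := by
    refine continuous_finsetSum _ fun j _ => ?_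
    have h1 := (continuous_id (X := Fin m → Matrix (Fin d × Fin d) (Fin d × Fin d) ℂ)).prodMk
      (continuous_const (y := G.ζ))
    have h2 := (G.circuit.continuous_prob j).comp h1
    exact continuous_const.mul h2
  have himg : (fun X : Fin m → Matrix (Fin d × Fin d) (Fin d × Fin d) ℂ =>
      G.success fun k => choi.symm (X k)) '' Set.univ.pi (fun k => choi '' 𝓧 k) =
      G.freeSuccesses 𝓧 := by
    ext q
    constructor
    · rintro ⟨X, hX, rfl⟩
      refine ⟨_, fun k => ?_, rfl⟩
      obtain ⟨Φ, hΦ, h⟩ := hX k trivial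
      rwa [← h, LinearEquiv.symm_apply_apply]
    · rintro ⟨Φ, hΦ, rfl⟩
      exact ⟨fun k => choi (Φ k), fun k _ => ⟨_, hΦ k, rfl⟩, by simp⟩
  have hcomp : IsCompact (G.freeSuccesses 𝓧) :=
    himg ▸ (isCompact_univ_pi h𝓧).image hcont
  have hne' : (G.freeSuccesses 𝓧).Nonempty := by
    choose Φ hΦ using hne
    exact ⟨_, Φ, hΦ, rfl⟩
  exact hcomp.isGreatest_sSup hne'

end Attained

/-! ### Upper bound on the advantage -/

section UpperBound

lemma trace_mul_nonneg {n : Type} [Fintype n] {E X : Matrix n n ℂ} (hE : E.PosSemidef)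
    (hX : X.PosSemidef) : 0 ≤ (E * X).trace := by
  obtain ⟨B, rfl⟩ := hE.exists_eq_conjTranspose_mul_self
  rw [Matrix.mul_assoc, Matrix.trace_mul_comm, Matrix.mul_assoc, ← Matrix.mul_assoc]
  exact (hX.mul_mul_conjTranspose_same B).trace_nonneg

variable {d : ℕ}

/-- The outcome probabilities are monotone in the channels and the input, for the order given by
completely positive maps and positive semidefinite matrices. -/
lemma Circuit.prob_le {N a m : ℕ} (c : Circuit d N a m) (j : Fin N)
    {Θ Φ : Fin m → SuperOp (Fin d) (Fin d)} {s : Fin m → ℝ} (hs : ∀ k, 0 ≤ s k)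
    (hΘ : ∀ k, (choi (Θ k)).PosSemidef) (hΦ : ∀ k, (choi (Φ k)).PosSemidef)
    (hle : ∀ k, (choi (s k • Φ k - Θ k)).PosSemidef)
    {ρ σ : Matrix (Fin a × Fin d) (Fin a × Fin d) ℂ} (hρ : ρ.PosSemidef) (hσ : σ.PosSemidef)
    {t : ℝ} (ht : 0 ≤ t) (hρσ : (t • σ - ρ).PosSemidef) :
    c.prob Θ ρ j ≤ t * (∏ k, s k) * c.prob Φ σ j := by
  -- With ancilla identities suppressed: ts Φ(σ) − Θ(ρ) = s Φ(tσ − ρ) + (sΦ − Θ)(ρ). The factor t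
  -- thus accumulates the product of the s k along the circuit.
  have hstep : ∀ (a m : ℕ) (Θ Φ : Fin (m + 1) → SuperOp (Fin d) (Fin d)) (s : Fin (m + 1) → ℝ)
      (ρ σ : Matrix (Fin a × Fin d) (Fin a × Fin d) ℂ) (t : ℝ), (∀ k, 0 ≤ s k) →
      (∀ k, (choi (Φ k)).PosSemidef) → (∀ k, (choi (s k • Φ k - Θ k)).PosSemidef) →
      ρ.PosSemidef → (t • σ - ρ).PosSemidef →
      ((t * s 0) • ampliation (Fin a) (Φ 0) σ - ampliation (Fin a) (Θ 0) ρ).PosSemidef := by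
    intro a m Θ Φ s ρ σ t hs hΦ hle hρ hρσ
    have h1 := (posSemidef_ampliation (hΦ 0) hρσ).smul (hs 0)
    have h2 := posSemidef_ampliation (hle 0) hρ
    have h3 : ampliation (Fin a) (Φ 0) (t • σ - ρ) =
        t • ampliation (Fin a) (Φ 0) σ - ampliation (Fin a) (Φ 0) ρ := by
      change ((ampliationₗ (Fin a) (Φ 0)).restrictScalars ℝ) (t • σ - ρ) = _
      rw [map_sub, map_smul]
      rfl
    convert h1.add h2 using 1
    rw [ampliation_sub_left, ampliation_smul_left, h3, smul_sub, smul_smul, mul_comm t]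
    abel
  induction c generalizing t with
  | @measure a E =>
    have h := trace_mul_nonneg (E.posSemidef j) (hstep a 0 Θ Φ s ρ σ t hs hΦ hle hρ hρσ)
    rw [Matrix.mul_sub, Matrix.mul_smul, Matrix.trace_sub, Matrix.trace_smul] at h
    have h' := (Complex.nonneg_iff.1 h).1
    rw [Complex.sub_re, Complex.smul_re, smul_eq_mul, sub_nonneg] at h'
    simpa [Circuit.prob_measure] using h'
  | @gate a b m G hG rest ih =>
    rw [Circuit.prob_gate, Circuit.prob_gate, Fin.prod_univ_succ, ← mul_assoc]
    refine ih (fun k => hs _) (fun k => hΘ _) (fun k => hΦ _) (fun k => hle _)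
      (hG.map_posSemidef (posSemidef_ampliation (hΘ 0) hρ))
      (hG.map_posSemidef (posSemidef_ampliation (hΦ 0) hσ)) (mul_nonneg ht (hs 0)) ?_
    have h := hG.map_posSemidef (hstep a m Θ Φ s ρ σ t hs hΦ hle hρ hρσ)
    rwa [map_sub, LinearMap.map_smul_of_tower] at h

lemma CombGame.success_le {m : ℕ} (G : CombGame d m)
    {Θ Φ : Fin m → SuperOp (Fin d) (Fin d)} {s : Fin m → ℝ} (hs : ∀ k, 0 ≤ s k)
    (hΘ : ∀ k, (choi (Θ k)).PosSemidef) (hΦ : ∀ k, (choi (Φ k)).PosSemidef)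
    (hle : ∀ k, (choi (s k • Φ k - Θ k)).PosSemidef) :
    G.success Θ ≤ (∏ k, s k) * G.success Φ := by
  unfold CombGame.success
  rw [Finset.mul_sum]
  refine Finset.sum_le_sum fun j _ => ?_
  have h := G.circuit.prob_le j hs hΘ hΦ hle G.ζ_state.1 G.ζ_state.1 zero_le_one
    (by rw [one_smul, sub_self]; exact .zero)
  rw [one_mul] at h
  calc G.p j * G.branch j Θ ≤ G.p j * ((∏ k, s k) * G.branch j Φ) :=
        mul_le_mul_of_nonneg_left h (G.p_nonneg j)
    _ = _ := by ring

end UpperBound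

/-! ### Duality: witnesses for the robustness -/

section Robustness

variable {d : ℕ}

/-- A channel is a combination of a free one and a channel with robustness weights. -/
lemma exists_of_mem_robustnessSet {Θ : SuperOp (Fin d) (Fin d)}
    {𝓧 : Set (SuperOp (Fin d) (Fin d))} {r : ℝ} (hr : r ∈ robustnessSet Θ 𝓧) :
    ∃ Φ ∈ 𝓧, ∃ Λ ∈ channels d, (1 + r) • Φ - Θ = r • Λ := by
  obtain ⟨h0, Λ, hΛ, h⟩ := hr
  refine ⟨_, h, Λ, hΛ, ?_⟩
  rw [smul_smul, mul_inv_cancel₀ (by positivity), one_smul, add_sub_cancel_left]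

/-- A free channel whose Choi matrix has the smallest kernel among the free channels. -/
lemma exists_ker_choi_le {𝓧 : Set (SuperOp (Fin d) (Fin d))} (hsub : 𝓧 ⊆ channels d)
    (hconv : Convex ℝ 𝓧) (hne : 𝓧.Nonempty) :
    ∃ Φ₀ ∈ 𝓧, ∀ Φ ∈ 𝓧, ∀ v, choi Φ₀ *ᵥ v = 0 → choi Φ *ᵥ v = 0 := by
  obtain ⟨Φ₀, h₀, hmin⟩ := WellFounded.has_min
    (measure fun Φ : SuperOp (Fin d) (Fin d) =>
      Module.finrank ℂ (LinearMap.ker (choi Φ).mulVecLin)).wf 𝓧 hne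
  refine ⟨Φ₀, h₀, fun Φ hΦ => ?_⟩
  have hmid : (2⁻¹ : ℝ) • Φ₀ + (2⁻¹ : ℝ) • Φ ∈ 𝓧 :=
    hconv h₀ hΦ (by norm_num) (by norm_num) (by norm_num)
  -- The kernel of a sum of positive matrices lies in both kernels. As the midpoint is free,
  -- minimality of the dimension makes its kernel equal to that of `Φ₀`.
  have hker : ∀ (A B : SuperOp (Fin d) (Fin d)), (choi A).PosSemidef → (choi B).PosSemidef →
      LinearMap.ker (choi ((2⁻¹ : ℝ) • A + (2⁻¹ : ℝ) • B)).mulVecLin ≤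
        LinearMap.ker (choi A).mulVecLin := by
    intro A B hA hB v hv
    rw [LinearMap.mem_ker, Matrix.mulVecLin_apply] at hv ⊢
    have hsum : choi ((2⁻¹ : ℝ) • A + (2⁻¹ : ℝ) • B) =
      (2⁻¹ : ℝ) • choi A + (2⁻¹ : ℝ) • choi B := rfl
    have h2 : (2⁻¹ : ℝ) • (star v ⬝ᵥ choi A *ᵥ v) + (2⁻¹ : ℝ) • (star v ⬝ᵥ choi B *ᵥ v) = 0 := by
      have := congrArg (star v ⬝ᵥ ·) hv
      simpa [hsum, Matrix.add_mulVec, Matrix.smul_mulVec] using this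
    have hA' := hA.dotProduct_mulVec_nonneg v
    have hB' := hB.dotProduct_mulVec_nonneg v
    rw [← smul_add, smul_eq_zero_iff_right (by norm_num), add_eq_zero_iff_of_nonneg hA' hB'] at h2
    exact (hA.dotProduct_mulVec_zero_iff v).1 h2.1
  have hP₀ := (hsub h₀).posSemidef_choi
  have hP := (hsub hΦ).posSemidef_choi
  have heq := Submodule.eq_of_le_of_finrank_le (hker Φ₀ Φ hP₀ hP)
    (not_lt.1 (hmin _ hmid))
  intro v hv
  have hv' : v ∈ LinearMap.ker (choi ((2⁻¹ : ℝ) • Φ₀ + (2⁻¹ : ℝ) • Φ)).mulVecLin := by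
    rw [heq]; exact hv
  rw [add_comm] at hv'
  exact hker Φ Φ₀ hP hP₀ hv'

/-- The generalised robustness has an optimal witness. -/
lemma exists_witness (hd : 0 < d) {Θ : SuperOp (Fin d) (Fin d)} (hΘ : Θ ∈ channels d)
    {𝓧 : Set (SuperOp (Fin d) (Fin d))} (hsub : 𝓧 ⊆ channels d) (hconv : Convex ℝ 𝓧)
    {R : ℝ} (hR : IsLeast (robustnessSet Θ 𝓧) R) :
    ∃ W : Matrix (Fin d × Fin d) (Fin d × Fin d) ℂ, W.PosSemidef ∧ ∃ Φs ∈ 𝓧,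
      0 < (W * choi Φs).trace.re ∧
      (∀ Φ ∈ 𝓧, (W * choi Φ).trace.re ≤ (W * choi Φs).trace.re) ∧
      (W * choi Θ).trace.re = (1 + R) * (W * choi Φs).trace.re := by
  obtain ⟨Φs, hΦs, Λ, hΛ, hdec⟩ := exists_of_mem_robustnessSet hR.1
  have hR0 : 0 ≤ R := hR.1.1
  obtain rfl | hRpos := hR0.eq_or_lt
  -- For R = 0 the channel Θ is itself free, and the identity is a witness since all channels have
  -- Choi trace d > 0.
  · rw [add_zero, one_smul, zero_smul, sub_eq_zero] at hdec
    subst hdec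
    have htr : ∀ Φ ∈ channels d,
        ((1 : Matrix (Fin d × Fin d) (Fin d × Fin d) ℂ) * choi Φ).trace.re = (d : ℝ) := fun Φ h => by
      rw [Matrix.one_mul, IsChannel.trace_choi h, Complex.natCast_re]
    refine ⟨1, .one, Φs, hΦs, ?_, fun Φ hΦ => ?_, by ring⟩
    · rw [htr _ hΘ]; exact_mod_cast hd
    · rw [htr _ hΘ, htr _ (hsub hΦ)]
  -- Free Choi matrices may all be singular. Passing to the support `P` of `Φ₀`, which also supports
  -- Θ and all free channels, provides the interior point that the separation needs.
  obtain ⟨Φ₀, hΦ₀, hker⟩ := exists_ker_choi_le hsub hconv ⟨Φs, hΦs⟩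
  obtain ⟨P, hPH, hP0, ε, hε, hgap⟩ := (hsub hΦ₀).posSemidef_choi.exists_support
  have hP : ∀ Φ ∈ 𝓧, choi Φ * (1 - P) = 0 := fun Φ hΦ => by
    ext i j
    have h1 : choi Φ₀ *ᵥ (fun k => (1 - P) k j) = 0 := by
      ext i'
      exact congrFun (congrFun hP0 i') j
    exact congrFun (hker Φ hΦ _ h1) i
  have hdec' : (1 + R) • choi Φs - choi Θ = R • choi Λ := congrArg choi hdec
  have hΛP := IsChannel.posSemidef_choi hΛ
  have hPΘ : choi Θ * (1 - P) = 0 := by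
    refine (IsChannel.posSemidef_choi hΘ).mul_eq_zero_of_le (Y := (1 + R) • choi Φs) ?_ ?_
    · rw [hdec']; exact hΛP.smul hR0
    · rw [Matrix.smul_mul, hP _ hΦs, smul_zero]
  -- The matrices dominated on `P` by 1 + R times some free channel. Off `P` nothing is required, so
  -- that 0 can be interior; `choi Θ` is shown not to be.
  let A : Set (Matrix (Fin d × Fin d) (Fin d × Fin d) ℂ) :=
    {X | ∃ Φ ∈ 𝓧, ∀ v, 0 ≤ quadRe ((1 + R) • choi Φ - X) (P *ᵥ v)}
  have hAconv : Convex ℝ A := by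
    rintro X ⟨Φ, hΦ, hX⟩ Y ⟨Ψ, hΨ, hY⟩ a b ha hb hab
    refine ⟨a • Φ + b • Ψ, hconv hΦ hΨ ha hb hab, fun v => ?_⟩
    have : (1 + R) • choi (a • Φ + b • Ψ) - (a • X + b • Y) =
        a • ((1 + R) • choi Φ - X) + b • ((1 + R) • choi Ψ - Y) := by
      change (1 + R) • (a • choi Φ + b • choi Ψ) - _ = _
      module
    rw [this, quadRe_add, quadRe_smul, quadRe_smul]
    exact add_nonneg (mul_nonneg ha (hX v)) (mul_nonneg hb (hY v))
  have h0 : (0 : Matrix (Fin d × Fin d) (Fin d × Fin d) ℂ) ∈ interior A := by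
    refine mem_interior.2 ⟨{X | ∑ i, ∑ j, ‖X i j‖ < ε}, fun X hX => ⟨Φ₀, hΦ₀, fun v => ?_⟩, ?_, ?_⟩
    · have h1 := (le_abs_self _).trans (abs_quadRe_le X (P *ᵥ v))
      have h2 := normSq_nonneg (P *ᵥ v)
      rw [quadRe_sub, quadRe_smul]
      have h3 : (∑ i, ∑ j, ‖X i j‖) * normSq (P *ᵥ v) ≤ ε * normSq (P *ᵥ v) :=
        mul_le_mul_of_nonneg_right (le_of_lt hX) h2
      nlinarith [hgap v, mul_nonneg hε.le h2]
    · refine isOpen_lt ?_ continuous_const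
      exact continuous_finsetSum _ fun i _ => continuous_finsetSum _ fun j _ =>
        (continuous_id.matrix_elem i j).norm
    · simpa using hε
  have hΘA : choi Θ ∉ interior A := by
    intro hmem
    -- An interior Θ could be scaled by some 1 + t with 0 < t < R and still be dominated, which
    -- would lower the robustness to (R − t)/(1 + t).
    have hcont : Continuous fun t : ℝ => (1 + t) • choi Θ :=
      (continuous_const.add continuous_id).smul continuous_const
    have hev : ∀ᶠ t in nhds (0 : ℝ), (1 + t) • choi Θ ∈ A :=
      (hcont.tendsto' 0 (choi Θ) (by simp)).eventually (mem_interior_iff_mem_nhds.1 hmem)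
    obtain ⟨t, ⟨Φ, hΦ, ht⟩, ht0, htR⟩ :=
      ((hev.filter_mono nhdsWithin_le_nhds).and (Ioo_mem_nhdsGT hRpos)).exists
    set K := (1 + R) • choi Φ - (1 + t) • choi Θ with hK
    have hKH : K.IsHermitian :=
      ((hsub hΦ).posSemidef_choi.1.smul (IsSelfAdjoint.all _)).sub
        ((IsChannel.posSemidef_choi hΘ).1.smul (IsSelfAdjoint.all _))
    -- Since `K` lives on the support `P`, positivity on the range of `P` is full positivity.
    have hKP : K * P = K := by
      have : K * (1 - P) = 0 := by
        rw [hK, Matrix.sub_mul, Matrix.smul_mul, Matrix.smul_mul, hP _ hΦ, hPΘ, smul_zero,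
          smul_zero, sub_zero]
      rw [Matrix.mul_sub, Matrix.mul_one, sub_eq_zero] at this
      exact this.symm
    have hPK : P * K = K := by
      have := congrArg Matrix.conjTranspose hKP
      rwa [Matrix.conjTranspose_mul, hKH.eq, hPH.eq] at this
    have hKpos : K.PosSemidef := posSemidef_of_quadRe hKH fun v => by
      convert ht v using 1
      rw [quadRe, quadRe, Matrix.star_mulVec, hPH.eq, ← Matrix.dotProduct_mulVec,
        Matrix.mulVec_mulVec, Matrix.mulVec_mulVec, hPK, hKP]
    have h1t : (0 : ℝ) < 1 + t := by linarith
    have hmem' : (R - t) / (1 + t) ∈ robustnessSet Θ 𝓧 := by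
      refine ⟨div_nonneg (by linarith) h1t.le,
        (R - t)⁻¹ • ((1 + R) • Φ - (1 + t) • Θ), isChannel_iff_choi.2 ⟨?_, ?_⟩, ?_⟩
      · exact hKpos.smul (inv_nonneg.2 (by linarith : (0 : ℝ) ≤ R - t))
      · refine (tracePreserving_iff _).1 fun Y => ?_
        simp only [LinearMap.smul_apply, LinearMap.sub_apply, Matrix.trace_smul, Matrix.trace_sub,
          (hsub hΦ).tracePreserving, IsChannel.tracePreserving hΘ]
        rw [← sub_smul, smul_smul, add_sub_add_left_eq_sub, inv_mul_cancel₀ (by linarith), one_smul]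
      · convert hΦ using 1
        have hRt : R - t ≠ 0 := by linarith
        have e1 : (1 + (R - t) / (1 + t))⁻¹ = (1 + t) / (1 + R) := by
          field_simp
          ring
        rw [e1]
        have hR1 : 1 + R ≠ 0 := by linarith
        match_scalars
        · field_simp
          ring
        · field_simp
    have hle := hR.2 hmem'
    rw [le_div_iff₀ h1t] at hle
    nlinarith
  obtain ⟨f, hf⟩ := geometric_hahn_banach_open_point hAconv.interior isOpen_interior hΘA
  have hfA : ∀ X ∈ A, f X ≤ f (choi Θ) := fun X hX => by
    have h1 : closure (interior A) ⊆ {X | f X ≤ f (choi Θ)} :=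
      closure_minimal (fun Y hY => (hf Y hY).le) (isClosed_le f.continuous continuous_const)
    exact h1 (by
      rw [hAconv.closure_interior_eq_closure_of_nonempty_interior ⟨0, h0⟩]
      exact subset_closure hX)
  have hfpos : ∀ X, (∀ v, 0 ≤ quadRe X v) → 0 ≤ f X := fun X hX => by
    have h1 : ∀ t : ℝ, 0 ≤ t → (1 + R) * f (choi Φs) - t * f X ≤ f (choi Θ) := fun t ht => by
      have := hfA ((1 + R) • choi Φs - t • X) ⟨Φs, hΦs, fun v => by
        rw [sub_sub_cancel, quadRe_smul]
        exact mul_nonneg ht (hX _)⟩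
      simpa using this
    by_contra! hneg
    -- `A` is stable under subtracting positive matrices. If f X < 0, this multiple of X raises f by
    -- the slack plus one, beyond its bound on `A`.
    have h2 := h1 ((|f (choi Θ) - (1 + R) * f (choi Φs)| + 1) / (-f X))
      (div_nonneg (by positivity) (by linarith))
    rw [div_mul_eq_mul_div, mul_div_assoc, show f X / -f X = -1 by
      rw [div_neg, div_self hneg.ne]] at h2
    linarith [le_abs_self (f (choi Θ) - (1 + R) * f (choi Φs))]
  obtain ⟨W, hW, hWf⟩ := exists_posSemidef_of_nonneg f.toLinearMap hfpos
  have hWf' : ∀ X, (W * X).trace.re = f X := fun X => (hWf X).symm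
  have hfree : ∀ Φ ∈ 𝓧, (1 + R) * f (choi Φ) ≤ f (choi Θ) := fun Φ hΦ => by
    have := hfA ((1 + R) • choi Φ) ⟨Φ, hΦ, fun v => by simp [quadRe]⟩
    simpa using this
  -- Positivity of f on Λ gives the bound opposite to `hfree`; together they force equality at `Φs`
  -- and its optimality among free channels.
  have hup : f (choi Θ) ≤ (1 + R) * f (choi Φs) := by
    have h1 := congrArg f hdec'
    have h2 := hfpos _ hΛP.quadRe_nonneg
    simp only [map_sub, map_smul, smul_eq_mul] at h1
    nlinarith
  have hpos : 0 < f (choi Θ) := by simpa using hf 0 h0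
  have h1R : 0 < 1 + R := by linarith
  refine ⟨W, hW, Φs, hΦs, ?_, fun Φ hΦ => ?_, le_antisymm ?_ ?_⟩
  · rw [hWf']; exact pos_of_mul_pos_right (hpos.trans_le hup) h1R.le
  · rw [hWf', hWf']; exact le_of_mul_le_mul_left ((hfree Φ hΦ).trans hup) h1R
  · rw [hWf', hWf']; exact hup
  · rw [hWf', hWf']; exact hfree _ hΦs

end Robustness

/-! ### Measure-and-prepare channels -/

section MeasurePrepare

variable {n m : Type} [Fintype n] [DecidableEq n]

/-- Measure the effect `E`, and prepare `ζ` if it occurs and `β` otherwise. -/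
def measurePrepare (E : Matrix n n ℂ) (ζ β : Matrix m m ℂ) : SuperOp n m where
  toFun X := (E * X).trace • ζ + ((1 - E) * X).trace • β
  map_add' X Y := by
    simp only [Matrix.mul_add, Matrix.trace_add, add_smul]
    abel
  map_smul' c X := by
    simp only [Matrix.mul_smul, Matrix.trace_smul, smul_eq_mul, mul_smul, smul_add,
      RingHom.id_apply]

lemma measurePrepare_apply (E : Matrix n n ℂ) (ζ β : Matrix m m ℂ) (X : Matrix n n ℂ) :
    measurePrepare E ζ β X = (E * X).trace • ζ + ((1 - E) * X).trace • β := rfl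

lemma choi_measurePrepare (E : Matrix n n ℂ) (ζ β : Matrix m m ℂ) :
    choi (measurePrepare E ζ β) = Eᵀ ⊗ₖ ζ + (1 - E)ᵀ ⊗ₖ β := by
  ext x y
  simp [choi_apply, measurePrepare_apply, Matrix.trace_mul_single, Matrix.one_apply,
    eq_comm (a := y.1)]

lemma isChannel_measurePrepare [Fintype m] {E : Matrix n n ℂ} (hE : E.PosSemidef)
    (hE' : (1 - E).PosSemidef) {ζ β : Matrix m m ℂ} (hζ : IsState ζ) (hβ : IsState β) :
    IsChannel (measurePrepare E ζ β) := by
  classical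
  refine ⟨fun a X hX => posSemidef_ampliation ?_ hX, fun X => ?_⟩
  · rw [choi_measurePrepare]
    exact (hE.transpose.kronecker hζ.1).add (hE'.transpose.kronecker hβ.1)
  · rw [measurePrepare_apply, Matrix.trace_add, Matrix.trace_smul, Matrix.trace_smul, hζ.2, hβ.2,
      smul_eq_mul, smul_eq_mul, mul_one, mul_one, ← Matrix.trace_add, ← Matrix.add_mul,
      add_sub_cancel, Matrix.one_mul]

/-- The POVM which tests one effect. -/
def POVM.test (E : Matrix n n ℂ) (hE : E.PosSemidef) (hE' : (1 - E).PosSemidef) : POVM n 2 where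
  effect := ![E, 1 - E]
  posSemidef j := by fin_cases j <;> assumption
  sum_eq_one := by simp

end MeasurePrepare

/-! ### The game that multiplies witnesses, and the maximal advantage -/

section ProductGame

variable {d a : ℕ}

/-- Testing the effect `E k` in slot `k`, where a failure leads to a state `β` that fails all the
later tests, succeeds with the product of the probabilities of the single tests. -/
lemma exists_circuit_prob_eq_prod {ζ β : Matrix (Fin a × Fin d) (Fin a × Fin d) ℂ}
    (hζ : IsState ζ) (hβ : IsState β) (m : ℕ)
    (E : Fin (m + 1) → Matrix (Fin a × Fin d) (Fin a × Fin d) ℂ)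
    (hE : ∀ k, (E k).PosSemidef) (hE' : ∀ k, (1 - E k).PosSemidef)
    (hEβ : ∀ k Φ, (E k * ampliation (Fin a) Φ β).trace = 0) :
    ∃ c : Circuit d 2 a (m + 1), ∀ (Φ : Fin (m + 1) → SuperOp (Fin d) (Fin d)) (s t : ℂ),
      c.prob Φ (s • ζ + t • β) 0 =
        (s * ∏ k, (E k * ampliation (Fin a) (Φ k) ζ).trace).re := by
  have hlin : ∀ (F : Matrix (Fin a × Fin d) (Fin a × Fin d) ℂ) (Φ : SuperOp (Fin d) (Fin d))
      (s t : ℂ), (F * ampliation (Fin a) Φ β).trace = 0 →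
      (F * ampliation (Fin a) Φ (s • ζ + t • β)).trace =
      s * (F * ampliation (Fin a) Φ ζ).trace := by
    intro F Φ s t h
    have : ampliation (Fin a) Φ (s • ζ + t • β) =
        s • ampliation (Fin a) Φ ζ + t • ampliation (Fin a) Φ β := by
      change ampliationₗ (Fin a) Φ (s • ζ + t • β) = _
      rw [map_add, map_smul, map_smul]
      rfl
    rw [this, Matrix.mul_add, Matrix.mul_smul, Matrix.mul_smul, Matrix.trace_add,
      Matrix.trace_smul, Matrix.trace_smul, h, smul_zero, add_zero, smul_eq_mul]
  -- After a gate the state is a combination of ζ and β weighted by passing and failing. Hence the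
  -- induction runs over all inputs sζ + tβ; only the ζ-part can pass later tests.
  induction m with
  | zero =>
    refine ⟨.measure (POVM.test (E 0) (hE 0) (hE' 0)), fun Φ s t => ?_⟩
    rw [Circuit.prob_measure]
    change (E 0 * _).trace.re = _
    rw [hlin _ _ _ _ (hEβ _ _)]
    simp
  | succ m ih =>
    obtain ⟨c, hc⟩ := ih (fun k => E k.succ) (fun k => hE _) (fun k => hE' _) fun k => hEβ _
    refine ⟨.gate _ (isChannel_measurePrepare (hE 0) (hE' 0) hζ hβ) c, fun Φ s t => ?_⟩
    rw [Circuit.prob_gate, measurePrepare_apply, hc, hlin _ _ _ _ (hEβ _ _), mul_assoc,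
      Fin.prod_univ_succ fun k => (E k * ampliation (Fin a) (Φ k) ζ).trace]

/-- The game in which the outcome `0` has probability one. -/
def CombGame.ofCircuit {m : ℕ} (c : Circuit d 2 a m)
    {ζ : Matrix (Fin a × Fin d) (Fin a × Fin d) ℂ} (hζ : IsState ζ) : CombGame d m where
  N := 2
  p := ![1, 0]
  p_nonneg j := by fin_cases j <;> simp
  p_sum := by simp
  a := a
  ζ := ζ
  ζ_state := hζ
  circuit := c

lemma CombGame.success_ofCircuit {m : ℕ} (c : Circuit d 2 a m)
    {ζ : Matrix (Fin a × Fin d) (Fin a × Fin d) ℂ} (hζ : IsState ζ)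
    (Φ : Fin m → SuperOp (Fin d) (Fin d)) :
    (CombGame.ofCircuit c hζ).success Φ = c.prob Φ ζ 0 := by
  change ∑ j : Fin 2, (![1, 0] : Fin 2 → ℝ) j * c.prob Φ ζ j = _
  simp [Fin.sum_univ_two]

/-- The isometry which adds the flag level to the ancilla. -/
def flagIsometry (d : ℕ) : Matrix (Fin (d + 1) × Fin d) (Fin d × Fin d) ℂ :=
  Matrix.of fun x y => if x = (y.1.castSucc, y.2) then 1 else 0

lemma flagIsometry_isometry : (flagIsometry d)ᴴ * flagIsometry d = 1 := by
  ext x y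
  simp only [Matrix.mul_apply, flagIsometry, Matrix.conjTranspose_apply, Matrix.of_apply,
    apply_ite star, star_one, star_zero, mul_ite, mul_one, mul_zero, Finset.sum_ite_eq',
    Finset.mem_univ, if_true, Matrix.one_apply]
  refine if_congr ?_ rfl rfl
  simp [Prod.ext_iff, eq_comm]

/-- The maximally entangled state of the system and the unflagged levels of the ancilla. -/
def entangledState (d : ℕ) : Matrix (Fin (d + 1) × Fin d) (Fin (d + 1) × Fin d) ℂ :=
  (d : ℂ)⁻¹ • Matrix.vecMulVec (fun x => if x.1 = x.2.castSucc then 1 else 0)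
    (star fun x => if x.1 = x.2.castSucc then 1 else 0)

lemma isState_entangledState (hd : 0 < d) : IsState (entangledState d) := by
  refine ⟨(Matrix.posSemidef_vecMulVec_self_star _).smul (by positivity), ?_⟩
  rw [entangledState, Matrix.trace_smul, Matrix.trace_vecMulVec, dotProduct, Fintype.sum_prod_type,
    Finset.sum_comm]
  simp [hd.ne']

/-- A slot fed with this state outputs an embedded Choi matrix, so a test embedded by the same
isometry evaluates a linear functional of it, up to 1/d. -/
lemma ampliation_entangledState (Φ : SuperOp (Fin d) (Fin d)) :
    ampliation (Fin (d + 1)) Φ (entangledState d) =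
      (d : ℂ)⁻¹ • (flagIsometry d * choi Φ * (flagIsometry d)ᴴ) := by
  have h : ∀ x y, (flagIsometry d * choi Φ * (flagIsometry d)ᴴ) x y =
      ∑ i, ∑ j, (if x.1 = Fin.castSucc i ∧ y.1 = Fin.castSucc j then 1 else 0) *
        choi Φ (i, x.2) (j, y.2) := fun x y => by
    simp only [Matrix.mul_apply, flagIsometry, Matrix.conjTranspose_apply, Matrix.of_apply,
      Fintype.sum_prod_type, Prod.ext_iff, ite_and, apply_ite star, star_one, star_zero, ite_mul,
      mul_ite, one_mul, mul_one, zero_mul, mul_zero, Finset.sum_ite_irrel, Finset.sum_const_zero,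
      Finset.sum_ite_eq, Finset.mem_univ, if_true]
    simp only [← Finset.sum_filter]
    exact Finset.sum_comm
  ext x y
  rw [ampliation_apply_eq_sum, Matrix.smul_apply, h, Finset.smul_sum]
  refine Finset.sum_congr rfl fun i _ => ?_
  rw [Finset.smul_sum]
  refine Finset.sum_congr rfl fun j _ => ?_
  simp only [entangledState, Matrix.smul_apply, Matrix.vecMulVec_apply, Pi.star_apply, smul_eq_mul]
  split_ifs <;> simp_all

/-- The pure state of the flag level of the ancilla. -/
def flagState (hd : 0 < d) : Matrix (Fin (d + 1) × Fin d) (Fin (d + 1) × Fin d) ℂ :=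
  Matrix.single (Fin.last d, ⟨0, hd⟩) (Fin.last d, ⟨0, hd⟩) 1

lemma isState_flagState (hd : 0 < d) : IsState (flagState hd) := by
  refine ⟨?_, Matrix.trace_single_eq_same _ _⟩
  rw [flagState, ← Matrix.diagonal_single]
  refine .diagonal fun i => ?_
  by_cases h : i = (Fin.last d, ⟨0, hd⟩) <;> simp [h]

/-- A slot does not touch the ancilla: the flag level stays orthogonal to the range of the isometry,
so a failed run fails every later test. -/
lemma conjTranspose_flagIsometry_mul_ampliation (hd : 0 < d) (Φ : SuperOp (Fin d) (Fin d)) :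
    (flagIsometry d)ᴴ * ampliation (Fin (d + 1)) Φ (flagState hd) = 0 := by
  ext x y
  simp only [Matrix.mul_apply, flagIsometry, Matrix.conjTranspose_apply, Matrix.of_apply,
    apply_ite star, star_one, star_zero, ite_mul, one_mul, zero_mul, Finset.sum_ite_eq',
    Finset.mem_univ, if_true, Matrix.zero_apply, ampliation_apply_eq_sum]
  refine Finset.sum_eq_zero fun i _ => Finset.sum_eq_zero fun j _ => ?_
  have : Fin.last d ≠ x.1.castSucc := (Fin.castSucc_lt_last _).ne'
  simp [flagState, this]

/-- There is a game whose success probability is, up to positive factors, a given product of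
positive functionals of the channels. -/
lemma exists_combGame_success_eq_prod (hd : 0 < d) {m : ℕ} (hm : 0 < m)
    (W : Fin m → Matrix (Fin d × Fin d) (Fin d × Fin d) ℂ) (hW : ∀ k, (W k).PosSemidef) :
    ∃ (G : CombGame d m) (κ : Fin m → ℝ), (∀ k, 0 < κ k) ∧
      ∀ Φ : Fin m → SuperOp (Fin d) (Fin d), (∀ k, Φ k ∈ channels d) →
        G.success Φ = ∏ k, κ k * (W k * choi (Φ k)).trace.re := by
  obtain ⟨m, rfl⟩ := Nat.exists_eq_succ_of_ne_zero hm.ne'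
  have hF := fun k => (hW k).mul_mul_conjTranspose_same (flagIsometry d)
  choose ε hε hε' using fun k => exists_one_sub_smul_posSemidef (hF k)
  obtain ⟨c, hc⟩ := exists_circuit_prob_eq_prod (isState_entangledState hd) (isState_flagState hd) m
    (fun k => ε k • (flagIsometry d * W k * (flagIsometry d)ᴴ))
    (fun k => (hF k).smul (hε k).le) hε' fun k Φ => by
      rw [Matrix.smul_mul, Matrix.mul_assoc, conjTranspose_flagIsometry_mul_ampliation,
        Matrix.mul_zero, smul_zero, Matrix.trace_zero]
  refine ⟨.ofCircuit c (isState_entangledState hd), fun k => ε k * (d : ℝ)⁻¹,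
    fun k => mul_pos (hε k) (by positivity), fun Φ hΦ => ?_⟩
  have h1 := hc Φ 1 0
  rw [one_smul, zero_smul, add_zero, one_mul] at h1
  rw [CombGame.success_ofCircuit, h1, ← Complex.ofReal_re (∏ k, _), Complex.ofReal_prod]
  congr 1
  refine Finset.prod_congr rfl fun k _ => ?_
  -- The traces must be real for the real part of their product to be the product of real parts.
  have hre : (W k * choi (Φ k)).trace = ((W k * choi (Φ k)).trace.re : ℂ) :=
    Complex.eq_re_of_ofReal_le (r := 0)
      (by simpa using trace_mul_nonneg (hW k) (hΦ k).posSemidef_choi)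
  have htr : (flagIsometry d * W k * (flagIsometry d)ᴴ *
      (flagIsometry d * choi (Φ k) * (flagIsometry d)ᴴ)).trace = (W k * choi (Φ k)).trace := by
    rw [Matrix.mul_assoc, Matrix.mul_assoc, Matrix.trace_mul_comm]
    simp only [Matrix.mul_assoc, flagIsometry_isometry, Matrix.mul_one]
    rw [← Matrix.mul_assoc _ (flagIsometry d), flagIsometry_isometry, Matrix.one_mul]
  rw [ampliation_entangledState, Matrix.smul_mul, Matrix.mul_smul, Matrix.trace_smul,
    Matrix.trace_smul, htr, hre]
  simp [mul_assoc]

/-- The maximal relative advantage over players with convex sets of free channels. -/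
lemma isGreatest_relativeAdvantages (hd : 0 < d) {m : ℕ} (hm : 0 < m)
    {Θ : SuperOp (Fin d) (Fin d)} (hΘ : Θ ∈ channels d)
    {𝓧 : Fin m → Set (SuperOp (Fin d) (Fin d))} (hsub : ∀ k, 𝓧 k ⊆ channels d)
    (hconv : ∀ k, Convex ℝ (𝓧 k)) (hcomp : ∀ k, IsCompact (choi '' 𝓧 k))
    {R : Fin m → ℝ} (hR : ∀ k, IsLeast (robustnessSet Θ (𝓧 k)) (R k)) :
    IsGreatest (relativeAdvantages Θ 𝓧) (∏ k, (1 + R k) - 1) := by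
  have hR1 : ∀ k, 0 ≤ 1 + R k := fun k => by linarith [(hR k).1.1]
  constructor
  · choose W hW Φs hΦs hpos hmax hΘW using fun k => exists_witness hd hΘ (hsub k) (hconv k) (hR k)
    obtain ⟨G, κ, hκ, hG⟩ := exists_combGame_success_eq_prod hd hm W hW
    have hbest : G.bestFree 𝓧 = ∏ k, κ k * (W k * choi (Φs k)).trace.re := by
      refine IsGreatest.csSup_eq ⟨⟨Φs, hΦs, hG _ fun k => hsub k (hΦs k)⟩, ?_⟩
      rintro _ ⟨Φ, hΦ, rfl⟩
      rw [hG _ fun k => hsub k (hΦ k)]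
      -- All factors are nonnegative, so the product is maximal when each factor is.
      refine Finset.prod_le_prod (fun k _ => mul_nonneg (hκ k).le ?_) fun k _ =>
        mul_le_mul_of_nonneg_left (hmax k _ (hΦ k)) (hκ k).le
      exact (Complex.nonneg_iff.1 (trace_mul_nonneg (hW k) (hsub k (hΦ k)).posSemidef_choi)).1
    have hbest0 : 0 < G.bestFree 𝓧 := by
      rw [hbest]
      exact Finset.prod_pos fun k _ => mul_pos (hκ k) (hpos k)
    refine ⟨G, hbest0, ?_⟩
    have hsucc : G.success (fun _ => Θ) = (∏ k, (1 + R k)) * G.bestFree 𝓧 := by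
      rw [hG _ fun _ => hΘ, hbest, ← Finset.prod_mul_distrib]
      refine Finset.prod_congr rfl fun k _ => ?_
      rw [hΘW]
      ring
    rw [hsucc]
    field_simp
  · rintro _ ⟨G, hG, rfl⟩
    -- The free channels from the optimal decompositions form a strategy whose success is at least
    -- that of Θ divided by ∏ (1 + R k), in every game.
    choose Φ hΦ Λ hΛ hdec using fun k => exists_of_mem_robustnessSet (hR k).1
    have h1 : G.success (fun _ => Θ) ≤ (∏ k, (1 + R k)) * G.success Φ :=
      G.success_le hR1 (fun _ => IsChannel.posSemidef_choi hΘ)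
        (fun k => (hsub k (hΦ k)).posSemidef_choi) fun k => by
          rw [hdec]
          exact (IsChannel.posSemidef_choi (hΛ k)).smul (hR k).1.1
    have h2 : G.success Φ ≤ G.bestFree 𝓧 :=
      (G.isGreatest_bestFree hcomp fun k => ⟨_, hΦ k⟩).2 ⟨Φ, hΦ, rfl⟩
    rw [div_le_iff₀ hG, sub_mul, one_mul, sub_le_sub_iff_right]
    exact h1.trans (mul_le_mul_of_nonneg_left h2 (Finset.prod_nonneg fun k _ => hR1 k))

end ProductGame

/-! ### Möbius inversion for the dividends -/

section Dividend

variable {ι : Type} [DecidableEq ι]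

/-- The dividends of the utility `∏ (1 + x k) - 1` are products. -/
lemma dividend_eq_prod {u : Finset ι → ℝ} {x : ι → ℝ}
    (hu : ∀ T, u T = ∏ k ∈ T, (1 + x k) - 1) {T : Finset ι} (hT : T.Nonempty) :
    dividend u T = ∏ k ∈ T, x k := by
  have hempty : dividend u ∅ = 0 := by
    rw [dividend, if_neg (by simp), hu]
    simp
  induction T using Finset.strongInduction with
  | H T ih =>
    have hexp : ∏ k ∈ T, (1 + x k) = ∑ t ∈ T.powerset, ∏ k ∈ t, x k := Finset.prod_one_add T
    rw [dividend]
    split_ifs with hc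
    · rw [Finset.sum_attach T.ssubsets (dividend u), hu, hexp,
        ← Finset.insert_erase (Finset.mem_powerset_self T),
        Finset.sum_insert (Finset.notMem_erase _ _)]
      change _ + ∑ t ∈ T.ssubsets, _ - 1 - _ = _
      -- The empty set is treated apart: its product 1 cancels the −1 of the utility and its
      -- dividend is 0. The induction hypothesis cancels the other proper subsets.
      have h0 : ∅ ∈ T.ssubsets := Finset.empty_mem_ssubsets hT
      rw [← Finset.add_sum_erase _ _ h0, ← Finset.add_sum_erase _ _ h0, hempty,
        Finset.prod_empty, Finset.sum_congr rfl fun t ht => ?_]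
      · ring
      · rw [Finset.mem_erase, Finset.mem_ssubsets] at ht
        exact (ih t ht.2 (Finset.nonempty_iff_ne_empty.2 ht.1)).symm
    · obtain ⟨k, rfl⟩ := Finset.card_eq_one.1
        (le_antisymm (not_lt.1 hc) (Finset.card_pos.2 hT))
      rw [hu]
      simp

lemma geomMean_pow {M : ℕ} (hM : M ≠ 0) {x : Fin M → ℝ} (hx : ∀ k, 0 ≤ x k) :
    geomMean x ^ M = ∏ k, x k :=
  Real.rpow_inv_natCast_pow (Finset.prod_nonneg fun k _ => hx k) hM

end Dividend

end SRT

end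

/-! ### The main theorem -/

theorem theorem3 {d D M : ℕ} (hd : 0 < d) (𝒯 : SRT.StarResourceTheory d D)
    (C : SRT.ApexCone (EuclideanSpace ℝ (Fin D))) (hC : C ∈ 𝒯.fortress)
    (𝓕 : Fin M → Set (EuclideanSpace ℝ (Fin D))) (h𝓕_inj : Function.Injective 𝓕)
    (h𝓕_range : Set.range 𝓕 = 𝒯.sections C)
    (Θ : SRT.SuperOp (Fin d) (Fin d)) (hΘ : Θ ∈ SRT.channels d) (hΘD : 𝒯.rep Θ ∈ 𝒯.domain C)
    (hfinite : ∀ k, (SRT.robustnessSet Θ (𝒯.channelsIn (𝓕 k))).Nonempty) :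
    -- all the extrema in the definitions are attained
    (∀ k, IsLeast (SRT.robustnessSet Θ (𝒯.channelsIn (𝓕 k)))
      (SRT.robustness Θ (𝒯.channelsIn (𝓕 k)))) ∧
    (∀ T : Finset (Fin M), T.Nonempty →
      (∀ G : SRT.CombGame d T.card,
        IsGreatest
          (G.freeSuccesses (SRT.coalitionSets (fun k => 𝒯.channelsIn (𝓕 k)) T))
          (G.bestFree (SRT.coalitionSets (fun k => 𝒯.channelsIn (𝓕 k)) T))) ∧
      IsGreatest
        (SRT.relativeAdvantages Θ (SRT.coalitionSets (fun k => 𝒯.channelsIn (𝓕 k)) T))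
        (SRT.utility Θ (fun k => 𝒯.channelsIn (𝓕 k)) T)) ∧
    -- the dividend of the full coalition
    SRT.dividend (SRT.utility Θ (fun k => 𝒯.channelsIn (𝓕 k))) Finset.univ =
      ∏ k, SRT.robustness Θ (𝒯.channelsIn (𝓕 k)) ∧
    ∏ k, SRT.robustness Θ (𝒯.channelsIn (𝓕 k)) =
      SRT.geomMean (fun k => SRT.robustness Θ (𝒯.channelsIn (𝓕 k))) ^ M := by
  have hsec : ∀ k, 𝓕 k ∈ SRT.freeSections 𝒯.free C.carrier := fun k =>
    h𝓕_range.subset (Set.mem_range_self k)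
  have hcomp : ∀ k, IsCompact (SRT.choi '' 𝒯.channelsIn (𝓕 k)) := fun k =>
    𝒯.isCompact_choi_channelsIn (SRT.isClosed_of_mem_freeSections 𝒯.free_compact.isClosed (hsec k))
  have hconv : ∀ k, Convex ℝ (𝒯.channelsIn (𝓕 k)) := fun k =>
    𝒯.convex_channelsIn (SRT.convex_of_mem_freeSections (hsec k))
  have hsub : ∀ k, 𝒯.channelsIn (𝓕 k) ⊆ SRT.channels d := fun k _ h => h.1
  have hR : ∀ k, IsLeast (SRT.robustnessSet Θ (𝒯.channelsIn (𝓕 k)))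
      (SRT.robustness Θ (𝒯.channelsIn (𝓕 k))) := fun k =>
    SRT.isLeast_robustness (hcomp k) (hfinite k)
  have hne : ∀ k, (𝒯.channelsIn (𝓕 k)).Nonempty := fun k => by
    obtain ⟨Φ, hΦ, -⟩ := SRT.exists_of_mem_robustnessSet (hR k).1
    exact ⟨Φ, hΦ⟩
  have hadv : ∀ T : Finset (Fin M), T.Nonempty → IsGreatest
      (SRT.relativeAdvantages Θ (SRT.coalitionSets (fun k => 𝒯.channelsIn (𝓕 k)) T))
      (∏ k ∈ T, (1 + SRT.robustness Θ (𝒯.channelsIn (𝓕 k))) - 1) := fun T hT => by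
    have h := SRT.isGreatest_relativeAdvantages hd (Finset.card_pos.2 hT) hΘ
      (𝓧 := SRT.coalitionSets (fun k => 𝒯.channelsIn (𝓕 k)) T)
      (fun _ => hsub _) (fun _ => hconv _) (fun _ => hcomp _) (fun _ => hR _)
    convert h using 2
    rw [← Finset.prod_coe_sort, ← (T.orderIsoOfFin rfl).toEquiv.prod_comp]
    rfl
  have hutil : ∀ T : Finset (Fin M), SRT.utility Θ (fun k => 𝒯.channelsIn (𝓕 k)) T =
      ∏ k ∈ T, (1 + SRT.robustness Θ (𝒯.channelsIn (𝓕 k))) - 1 := fun T => by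
    rw [SRT.utility]
    split_ifs with hT
    · simp [hT]
    · exact (hadv T (Finset.nonempty_iff_ne_empty.2 hT)).csSup_eq
  -- The case M = 0 must be excluded: there the dividend would be 0 but the empty product 1.
  have hM : Nonempty (Fin M) := by
    obtain ⟨A, hA⟩ := SRT.freeSections_nonempty (K := 𝒯.free) C.convex
    obtain ⟨k, -⟩ := h𝓕_range.superset hA
    exact ⟨k⟩
  refine ⟨hR, fun T hT => ⟨fun G => G.isGreatest_bestFree (fun _ => hcomp _) fun _ => hne _, ?_⟩,
    SRT.dividend_eq_prod hutil Finset.univ_nonempty, ?_⟩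
  · rw [hutil]
    exact hadv T hT
  · refine (SRT.geomMean_pow ?_ fun k => (hR k).1.1).symm
    rintro rfl
    exact hM.elim Fin.elim0
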